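/- Let $\mathcal S,\mathcal A$ be measurable spaces and consider a discounted constrained MDP with transition kernel $P$, initial distribution $\rho$, discount factor $\gamma\in(0,1)$, measurable reward $r_0:\mathcal S\times\mathcal A\to[0,1]$ and utilities $r_i:\mathcal S\times\mathcal A\to[-1,1]$, $i\in[m]$, $m\ge 1$. Let $\pi_\theta$, $\theta\in\mathbb R^d$, be stationary policies given by positive densities $\pi_\theta(a|s)$ with respect to a reference measure on $\mathcal A$. Let $V_i^\theta=\mathbb E\big[\sum_{t\ge0}\gamma^t r_i(s_t,a_t)\big]$, where $s_0\sim\rho$, $a_t\sim\pi_\theta(\cdot|s_t)$, $s_{t+1}\sim P(\cdot|s_t,a_t)$. Put $\Theta=\{\theta: V_i^\theta\ge0\ \forall i\in[m]\}$ and, for $\eta>0$, $B_\eta^\theta=V_0^\theta+\eta\sum_{i=1}^m\log V_i^\theta$. Assume that $\theta\mapsto\log\pi_\theta(a|s)$ is twice differentiable on $\mathbb R^d$ for all $(s,a)$, and that $\|\nabla_\theta\log\pi_\theta(a|s)\|\le M_g$ and $\|\nabla^2_\theta\log\pi_\theta(a|s)\|\le M_h$ for all $\theta\in\Theta$ and all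 $(s,a)$, where $M_g,M_h>0$. From $n$ independent trajectories $(s_t^j,a_t^j)_{t}$ under $\pi_\theta$, truncated at horizon $H$, form $$\hat V_i^\theta=\frac1n\sum_{j=1}^n\sum_{t=0}^{H-1}\gamma^t r_i(s_t^j,a_t^j),\qquad \hat\nabla V_i^\theta=\frac1n\sum_{j=1}^n\sum_{t=0}^{H-1}\sum_{t'=0}^{t}\gamma^t r_i(s_t^j,a_t^j)\,\nabla_\theta\log\pi_\theta(a_{t'}^j|s_{t'}^j),$$ $$\hat\nabla B_\eta^\theta=\hat\nabla V_0^\theta+\eta\sum_{i=1}^m\frac{\hat\nabla V_i^\theta}{\hat V_i^\theta}.$$ Then for every $m\ge1$ and $M_g>0$ there are thresholds $n_0(\gamma,\eta,\varepsilon,\delta,v)\in\mathbb N$ and $H_0(\gamma,\eta,\varepsilon,v)\in\mathbb N$, depending on nothing else (in particular not on $d$, the spaces, the MDP, the policies or $M_h$), with the following properties. (1) For all such MDPs and policies, all $\theta$ with $v:=\min_{i\in[m]}V_i^\theta>0$, and all $\eta>0$, $\varepsilon>0$, $\delta\in(0,1]$: the function $\theta'\mapsto B_\eta^{\theta'}$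 is differentiable at $\theta$, and for all $n\ge n_0(\gamma,\eta,\varepsilon,\delta,v)$ and $H\ge H_0(\gamma,\eta,\varepsilon,v)$, $$\mathbb P\big(\|\hat\nabla B_\eta^\theta-\nabla_\theta B_\eta^\theta\|\le\varepsilon\big)\ge1-\delta .$$ (2) $n_0=\mathcal O\big(\varepsilon^{-2}(1-\gamma)^{-6}v^{-4}\eta^2\ln(1/\delta)\big)$: for all $K$ and $\delta_0<1$ there is a constant $C$, depending only on $m,M_g,K,\delta_0$, such that $n_0\le C\,\varepsilon^{-2}(1-\gamma)^{-6}v^{-4}\eta^2\ln(1/\delta)$ whenever $\gamma\in(0,1)$, $\eta>0$, $0<\varepsilon\le K\eta$, $0<\delta\le\delta_0$, $0<v\le\frac1{1-\gamma}$ and $v^2\le K\eta$. (3) $H_0=\mathcal O\big(\ln\frac1{\varepsilon v}\big)$: for all $\gamma\in(0,1)$, $K$ and $q<1$ there is a constant $C$, depending only on $m,M_g,\gamma,K,q$, such that $H_0\le C\ln\frac1{\varepsilon v}$ whenever $0<\eta\le K$, $0<\varepsilon\le K$, $0<v\le\frac1{1-\gamma}$ and $\varepsilon v\le q$. -/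

import Mathlib

open MeasureTheory ProbabilityTheory

/-- An infinite-horizon discounted constrained Markov decision process with state space `S`,
action space `A` (arbitrary measurable spaces) and `m` constraints. Index `0` of `r` is the reward,
the indices `1, …, m` are the utilities. -/
structure CMDP (S A : Type*) [MeasurableSpace S] [MeasurableSpace A] (m : ℕ) where
  /-- transition dynamics `P(· | s, a)` -/
  P : Kernel (S × A) S
  isMarkov : IsMarkovKernel P
  /-- initial state distribution -/
  ρ : Measure S
  isProb : IsProbabilityMeasure ρ
  /-- reward and utilities -/
  r : Fin (m + 1) → S × A → ℝ
  measurable_r : ∀ i, Measurable (r i)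
  r_zero_mem : ∀ x, r 0 x ∈ Set.Icc (0 : ℝ) 1
  r_mem : ∀ i x, r i x ∈ Set.Icc (-1 : ℝ) 1
  /-- discount factor -/
  γ : ℝ
  γ_mem : γ ∈ Set.Ioo (0 : ℝ) 1

/-- A family of stationary stochastic policies `π_θ(a | s)`, `θ ∈ ℝ^d`. `dens θ s a` is the
density of `π_θ(· | s)` at `a` with respect to a reference measure `ν` on `A` (e.g. the counting
measure for discrete actions, Lebesgue measure for continuous ones). The density is positive,
so that `log π_θ(a | s)` makes sense. -/
structure PolicyFamily (S A : Type*) [MeasurableSpace S] [MeasurableSpace A] (d : ℕ) where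
  ν : Measure A
  sFinite : SFinite ν
  dens : EuclideanSpace ℝ (Fin d) → S → A → ℝ
  measurable_dens : ∀ θ, Measurable (Function.uncurry (dens θ))
  dens_pos : ∀ θ s a, 0 < dens θ s a
  lintegral_dens : ∀ θ s, ∫⁻ a, ENNReal.ofReal (dens θ s a) ∂ν = 1

attribute [instance] CMDP.isMarkov CMDP.isProb PolicyFamily.sFinite

noncomputable section

variable {S A : Type*} [MeasurableSpace S] [MeasurableSpace A] {m d : ℕ}

/-- The policy `π_θ` as a kernel `s ↦ π_θ(· | s)`. -/
def PolicyFamily.kernel (π : PolicyFamily S A d) (θ : EuclideanSpace ℝ (Fin d)) : Kernel S A :=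
  Kernel.withDensity (Kernel.const S π.ν) (fun s a => ENNReal.ofReal (π.dens θ s a))

instance PolicyFamily.isMarkovKernel_kernel (π : PolicyFamily S A d)
    (θ : EuclideanSpace ℝ (Fin d)) : IsMarkovKernel (π.kernel θ) := by
  refine ⟨fun s => ⟨?_⟩⟩
  have h : Measurable (Function.uncurry fun s a => ENNReal.ofReal (π.dens θ s a)) :=
    (π.measurable_dens θ).ennreal_ofReal
  rw [PolicyFamily.kernel, Kernel.withDensity_apply' _ h]
  simpa using π.lintegral_dens θ s

/-- `log π_θ(a | s)` as a function of `θ`. -/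
def PolicyFamily.logDens (π : PolicyFamily S A d) (x : S × A) (θ : EuclideanSpace ℝ (Fin d)) : ℝ :=
  Real.log (π.dens θ x.1 x.2)

/-- The score `∇_θ log π_θ(a | s)`. -/
def PolicyFamily.score (π : PolicyFamily S A d) (x : S × A) (θ : EuclideanSpace ℝ (Fin d)) :
    EuclideanSpace ℝ (Fin d) :=
  gradient (π.logDens x) θ

namespace CMDP

/-- One step of the state-action chain: `s' ∼ P(· | s, a)`, then `a' ∼ π_θ(· | s')`. -/
def stepKernel (M : CMDP S A m) (π : PolicyFamily S A d) (θ : EuclideanSpace ℝ (Fin d)) :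
    Kernel (S × A) (S × A) :=
  M.P.compProd (Kernel.prodMkLeft (S × A) (π.kernel θ))

instance (M : CMDP S A m) (π : PolicyFamily S A d) (θ : EuclideanSpace ℝ (Fin d)) :
    IsMarkovKernel (M.stepKernel π θ) := by
  unfold stepKernel; infer_instance

/-- The step kernel, seen as a kernel from the history up to time `t`. -/
def historyKernel (M : CMDP S A m) (π : PolicyFamily S A d) (θ : EuclideanSpace ℝ (Fin d))
    (t : ℕ) : Kernel (Finset.Iic t → S × A) (S × A) :=
  (M.stepKernel π θ).comap (fun h => h ⟨t, Finset.mem_Iic.2 le_rfl⟩) (measurable_pi_apply _)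

instance (M : CMDP S A m) (π : PolicyFamily S A d) (θ : EuclideanSpace ℝ (Fin d)) (t : ℕ) :
    IsMarkovKernel (M.historyKernel π θ t) := by
  unfold historyKernel; infer_instance

/-- The law of the trajectory `(s_0, a_0, s_1, a_1, …)` with `s_0 ∼ ρ`, `a_t ∼ π_θ(· | s_t)`,
`s_{t+1} ∼ P(· | s_t, a_t)`. -/
def trajLaw (M : CMDP S A m) (π : PolicyFamily S A d) (θ : EuclideanSpace ℝ (Fin d)) :
    Measure (ℕ → S × A) :=
  Kernel.trajMeasure (X := fun _ => S × A) (M.ρ.compProd (π.kernel θ)) (M.historyKernel π θ)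

instance (M : CMDP S A m) (π : PolicyFamily S A d) (θ : EuclideanSpace ℝ (Fin d)) :
    IsProbabilityMeasure (M.trajLaw π θ) := by
  unfold trajLaw; infer_instance

/-- The value function `V_i^θ(ρ)`. -/
def value (M : CMDP S A m) (π : PolicyFamily S A d) (i : Fin (m + 1))
    (θ : EuclideanSpace ℝ (Fin d)) : ℝ :=
  ∫ τ, ∑' t : ℕ, M.γ ^ t * M.r i (τ t) ∂(M.trajLaw π θ)

/-- The feasible set `Θ`. -/
def feasible (M : CMDP S A m) (π : PolicyFamily S A d) : Set (EuclideanSpace ℝ (Fin d)) :=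
  {θ | ∀ i : Fin m, 0 ≤ M.value π i.succ θ}

/-- `min_{i ∈ [m]} V_i^θ(ρ)` (used for `m ≥ 1` only). -/
def minValue (M : CMDP S A m) (π : PolicyFamily S A d) (θ : EuclideanSpace ℝ (Fin d)) : ℝ :=
  ⨅ i : Fin m, M.value π i.succ θ

/-- The log barrier `B_η^θ(ρ)`. -/
def logBarrier (M : CMDP S A m) (π : PolicyFamily S A d) (η : ℝ)
    (θ : EuclideanSpace ℝ (Fin d)) : ℝ :=
  M.value π 0 θ + η * ∑ i : Fin m, Real.log (M.value π i.succ θ)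

/-- Bounded score derivatives: `θ ↦ log π_θ(a | s)` is twice differentiable, and on the feasible
set its gradient and its Hessian are bounded by `Mg` and `Mh`, uniformly in `(s, a)`. -/
def BoundedScore (M : CMDP S A m) (π : PolicyFamily S A d) (Mg Mh : ℝ) : Prop :=
  (∀ x, Differentiable ℝ (π.logDens x)) ∧ (∀ x, Differentiable ℝ (π.score x)) ∧
    ∀ θ ∈ M.feasible π, ∀ x, ‖π.score x θ‖ ≤ Mg ∧ ‖fderiv ℝ (π.score x) θ‖ ≤ Mh

/-- The joint law of `n` independent trajectories. -/
def batchLaw (M : CMDP S A m) (π : PolicyFamily S A d) (θ : EuclideanSpace ℝ (Fin d)) (n : ℕ) :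
    Measure (Fin n → ℕ → S × A) :=
  Measure.pi fun _ => M.trajLaw π θ

/-- The value estimator from the batch `ω`, whose trajectories are truncated at horizon `H`. -/
def valueEst (M : CMDP S A m) (H : ℕ) {n : ℕ} (i : Fin (m + 1)) (ω : Fin n → ℕ → S × A) : ℝ :=
  (n : ℝ)⁻¹ * ∑ j, ∑ t ∈ Finset.range H, M.γ ^ t * M.r i (ω j t)

/-- The GPOMDP gradient estimator. -/
def gradEst (M : CMDP S A m) (π : PolicyFamily S A d) (θ : EuclideanSpace ℝ (Fin d)) (H : ℕ)
    {n : ℕ} (i : Fin (m + 1)) (ω : Fin n → ℕ → S × A) : EuclideanSpace ℝ (Fin d) :=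
  (n : ℝ)⁻¹ • ∑ j, ∑ t ∈ Finset.range H, ∑ t' ∈ Finset.range (t + 1),
    (M.γ ^ t * M.r i (ω j t)) • π.score (ω j t') θ

/-- The plug-in estimator of the log-barrier gradient. -/
def logBarrierGradEst (M : CMDP S A m) (π : PolicyFamily S A d) (η : ℝ)
    (θ : EuclideanSpace ℝ (Fin d)) (H : ℕ) {n : ℕ} (ω : Fin n → ℕ → S × A) :
    EuclideanSpace ℝ (Fin d) :=
  M.gradEst π θ H 0 ω +
    η • ∑ i : Fin m, (M.valueEst H i.succ ω)⁻¹ • M.gradEst π θ H i.succ ω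

end CMDP

end

/-! ### Dimension-free concentration in Hilbert space. -/

section Concentration

open Real

/-! The gradient of the barrier is `∇V_0 + η ∑ ∇V_i / V_i`, and the estimator plugs in empirical
versions of `V_i` and `∇V_i`. If all gradients are within `α` and all values within `β ≤ v / 2`,
with `‖∇V_i‖ ≤ L`, the plug-in error is at most `α + η m (2 α / v + 2 L β / v ^ 2)`
(`norm_barrier_sub_le`). It remains to choose `α`, `β` so that the three terms are at most `ε / 3`
each, and to reach these accuracies with `n` trajectories of length `H`.

The error of each estimator is a deviation from its mean plus a truncation bias. One trajectory
contributes a vector of norm at most `Mg / (1 - γ) ^ 2` to a gradient and a number of size at most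
`1 / (1 - γ)` to a value. A Hoeffding inequality in Hilbert space, whose constants do not see the
dimension, and a union bound over the `2 (m + 1)` estimators control the deviations. The bias is the
tail of a series dominated by `(t + 1) γ ^ t`, hence geometrically small in `H`.

The means converge to `∇V_i` by the policy gradient theorem, which is delicate because the score is
bounded on the feasible set only, and nothing is assumed near `θ`. Positive densities give a change
of measure from `θ` to `θ'` on each finite horizon (`lintegral_trajLaw_eq`). Pointwise continuity of
the likelihood ratio, together with its integral being 1, then makes every `V_i` continuous with no
bound on the score (`continuous_value`). Strict feasibility is therefore an open condition, so the
score is bounded on a ball around `θ`. There the likelihood ratios are bounded, which justifies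
differentiation under the integral and then term by term (`hasGradientAt_value`). -/

theorem exp_sub_self_le_exp_sq {x : ℝ} (hx : 0 ≤ x) : exp x - x ≤ exp (x ^ 2) := by
  rcases le_total x 1 with h | h
  · have h1 := abs_le.1 (Real.abs_exp_sub_one_sub_id_le (x := x) (by rwa [abs_of_nonneg hx]))
    have h2 := Real.add_one_le_exp (x ^ 2)
    linarith [h1.2]
  · have : exp x ≤ exp (x ^ 2) := exp_le_exp.2 (by nlinarith)
    linarith

theorem exp_sub_self_mono {x y : ℝ} (hx : 0 ≤ x) (hxy : x ≤ y) : exp x - x ≤ exp y - y := by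
  have h1 : exp y = exp x * exp (y - x) := by rw [← exp_add]; ring_nf
  have h2 := Real.add_one_le_exp (y - x)
  have h3 := Real.one_le_exp hx
  rw [h1]
  nlinarith

/-- As a function of `y = u ^ 2`, `cosh u` is the power series `∑ y ^ k / (2 k)!` with nonnegative
coefficients, hence convex on `y ≥ 0`; the inequality is Jensen's, term by term. -/
theorem cosh_le_of_sq_eq {a b p q : ℝ} (hp : 0 ≤ p) (hq : 0 ≤ q) (hpq : p + q = 1)
    {u : ℝ} (hu : u ^ 2 = p * a ^ 2 + q * b ^ 2) :
    cosh u ≤ p * cosh a + q * cosh b := by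
  refine hasSum_le (fun k => ?_) (Real.hasSum_cosh u)
    (((Real.hasSum_cosh a).mul_left p).add ((Real.hasSum_cosh b).mul_left q))
  have h := (convexOn_pow k).2 (x := a ^ 2) (y := b ^ 2) (sq_nonneg a) (sq_nonneg b) hp hq hpq
  simp only [smul_eq_mul] at h
  rw [← hu] at h
  have hk : (0 : ℝ) < ((2 * k).factorial : ℝ) := by positivity
  rw [pow_mul, pow_mul, pow_mul, ← mul_div_assoc, ← mul_div_assoc, ← add_div]
  gcongr

theorem integrable_cosh_norm_of_norm_le {F Ω' : Type*} [NormedAddCommGroup F]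
    [MeasurableSpace F] [BorelSpace F] [MeasurableSpace Ω'] {ν : Measure Ω'}
    [IsFiniteMeasure ν] {Y : Ω' → F} (hY : Measurable Y) {C : ℝ} (hC : ∀ ω, ‖Y ω‖ ≤ C) :
    Integrable (fun ω => cosh ‖Y ω‖) ν := by
  refine Integrable.of_bound (C := cosh C)
    (continuous_cosh.measurable.comp hY.norm).aestronglyMeasurable
    (Filter.Eventually.of_forall fun ω => ?_)
  rw [Real.norm_of_nonneg (cosh_pos _).le, cosh_le_cosh, abs_of_nonneg (norm_nonneg _)]
  exact (hC ω).trans (le_abs_self C)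

variable {E : Type*} [NormedAddCommGroup E] [InnerProductSpace ℝ E]

/-- With `c` the cosine of the angle between `s` and `x`, `‖s + x‖ ^ 2` is the average of `(‖s‖ ±
‖x‖) ^ 2` with weights `(1 ± c) / 2`. Convexity of `cosh` in the square of its argument and the
addition formulas do the rest. This replaces a dimension-dependent covering argument. -/
theorem cosh_norm_add_le (s x : E) :
    cosh ‖s + x‖ ≤ cosh ‖s‖ * cosh ‖x‖ +
      sinh ‖s‖ / ‖s‖ * (sinh ‖x‖ / ‖x‖ * inner ℝ s x) := by
  rcases eq_or_ne s 0 with rfl | hs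
  · simp
  rcases eq_or_ne x 0 with rfl | hx
  · simp
  have hs' : 0 < ‖s‖ := norm_pos_iff.2 hs
  have hx' : 0 < ‖x‖ := norm_pos_iff.2 hx
  set c : ℝ := inner ℝ s x / (‖s‖ * ‖x‖) with hc
  have hcabs : |c| ≤ 1 := abs_real_inner_div_norm_mul_norm_le_one s x
  have hin : inner ℝ s x = c * (‖s‖ * ‖x‖) := by rw [hc]; field_simp
  have hu : ‖s + x‖ ^ 2 = (1 + c) / 2 * (‖s‖ + ‖x‖) ^ 2 + (1 - c) / 2 * (‖s‖ - ‖x‖) ^ 2 := by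
    rw [norm_add_sq_real, hin]; ring
  have := cosh_le_of_sq_eq (by linarith [(abs_le.1 hcabs).1])
    (by linarith [(abs_le.1 hcabs).2]) (by ring) hu
  rw [cosh_add, cosh_sub] at this
  refine this.trans_eq ?_
  rw [hin]
  field_simp
  ring

/-- Makes the dependence on `x` linear in the inner product, so that it vanishes on averaging a
centred `x`. The price `‖s‖ (sinh ‖x‖ - ‖x‖)` is absorbed through `sinh ‖s‖ ≤ cosh ‖s‖`, and `cosh r
+ sinh r - r = exp r - r ≤ exp (B ^ 2)` for `0 ≤ r ≤ B`. -/
theorem cosh_norm_add_le_of_norm_le {B : ℝ} (s x : E) (hx : ‖x‖ ≤ B) :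
    cosh ‖s + x‖ ≤ cosh ‖s‖ * exp (B ^ 2) + sinh ‖s‖ / ‖s‖ * inner ℝ s x := by
  have hsn := norm_nonneg s
  have hxn := norm_nonneg x
  have hk : sinh ‖x‖ / ‖x‖ * inner ℝ s x ≤ inner ℝ s x + ‖s‖ * (sinh ‖x‖ - ‖x‖) := by
    rcases eq_or_ne x 0 with rfl | hx0
    · simp
    have hx' : 0 < ‖x‖ := norm_pos_iff.2 hx0
    have h1 : 0 ≤ sinh ‖x‖ / ‖x‖ - 1 := by
      rw [sub_nonneg, one_le_div hx']; exact self_le_sinh_iff.2 hxn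
    have h2 := real_inner_le_norm s x
    have h3 := mul_le_mul_of_nonneg_left h2 h1
    have h4 : (sinh ‖x‖ / ‖x‖ - 1) * (‖s‖ * ‖x‖) = ‖s‖ * (sinh ‖x‖ - ‖x‖) := by field_simp
    linarith
  have hc0 : 0 ≤ sinh ‖s‖ / ‖s‖ := div_nonneg (sinh_nonneg_iff.2 hsn) hsn
  have hcs : sinh ‖s‖ / ‖s‖ * ‖s‖ ≤ cosh ‖s‖ := by
    rcases eq_or_ne ‖s‖ 0 with h | h
    · rw [h]; simp
    · rw [div_mul_cancel₀ _ h]; exact (sinh_lt_cosh _).le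
  have hd : 0 ≤ sinh ‖x‖ - ‖x‖ := sub_nonneg.2 (self_le_sinh_iff.2 hxn)
  have h1 := cosh_norm_add_le s x
  have h2 := mul_le_mul_of_nonneg_left hk hc0
  have h3 := mul_le_mul_of_nonneg_right hcs hd
  have h4 : cosh ‖x‖ + (sinh ‖x‖ - ‖x‖) ≤ exp (B ^ 2) := by
    have := (exp_sub_self_mono hxn hx).trans (exp_sub_self_le_exp_sq (hxn.trans hx))
    rw [← cosh_add_sinh ‖x‖] at this
    linarith
  have h5 := mul_le_mul_of_nonneg_left h4 (cosh_pos ‖s‖).le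
  nlinarith

variable [CompleteSpace E] [MeasurableSpace E] [BorelSpace E] [SecondCountableTopology E]
  {Ω : Type*} [MeasurableSpace Ω] {μ : Measure Ω} [IsProbabilityMeasure μ]

theorem integral_cosh_norm_add_le {X : Ω → E} (hX : Measurable X) {B : ℝ}
    (hB : ∀ ω, ‖X ω‖ ≤ B) (h0 : ∫ ω, X ω ∂μ = 0) (s : E) :
    ∫ ω, cosh ‖X ω + s‖ ∂μ ≤ cosh ‖s‖ * exp (B ^ 2) := by
  have hXi : Integrable X μ := Integrable.of_bound (C := B) hX.aestronglyMeasurable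
    (Filter.Eventually.of_forall hB)
  have hin : Integrable (fun ω => inner ℝ s (X ω)) μ := hXi.const_inner s
  have h1 : ∫ ω, cosh ‖X ω + s‖ ∂μ ≤
      ∫ ω, (cosh ‖s‖ * exp (B ^ 2) + sinh ‖s‖ / ‖s‖ * inner ℝ s (X ω)) ∂μ := by
    refine integral_mono ?_ ((integrable_const _).add (hin.const_mul _)) fun ω => ?_
    · exact integrable_cosh_norm_of_norm_le (hX.add_const s) (C := B + ‖s‖)
        fun ω => (norm_add_le _ _).trans (by linarith [hB ω])
    · have := cosh_norm_add_le_of_norm_le s (X ω) (hB ω)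
      rwa [add_comm s] at this
  refine h1.trans_eq ?_
  rw [integral_add (integrable_const _) (hin.const_mul _),
    integral_const_mul (sinh ‖s‖ / ‖s‖), integral_inner hXi, h0]
  simp

/-- By independence, one summand can be integrated first with the sum of the others frozen as `s`;
each summand costs a factor `exp (B ^ 2)`. -/
theorem integral_cosh_norm_sum_le {X : Ω → E} (hX : Measurable X) {B : ℝ}
    (hB : ∀ ω, ‖X ω‖ ≤ B) (h0 : ∫ ω, X ω ∂μ = 0) (n : ℕ) :
    ∫ ω : Fin n → Ω, cosh ‖∑ j, X (ω j)‖ ∂(Measure.pi fun _ => μ) ≤ exp (n * B ^ 2) := by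
  induction n with
  | zero => simp
  | succ n ih =>
    have hmp := measurePreserving_piFinSuccAbove (fun _ : Fin (n + 1) => μ) 0
    have hsum : ∀ k : ℕ, Measurable fun ω : Fin k → Ω => ∑ j, X (ω j) := fun k =>
      Finset.measurable_sum _ fun j _ => hX.comp (measurable_pi_apply j)
    have hbd : ∀ (k : ℕ) (ω : Fin k → Ω), ‖∑ j, X (ω j)‖ ≤ k * B := fun k ω =>
      (norm_sum_le _ _).trans ((Finset.sum_le_sum fun j _ => hB (ω j)).trans_eq (by simp))
    have heq : ∫ ω : Fin (n + 1) → Ω, cosh ‖∑ j, X (ω j)‖ ∂(Measure.pi fun _ => μ) =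
        ∫ p : Ω × (Fin n → Ω), cosh ‖X p.1 + ∑ j, X (p.2 j)‖
          ∂(μ.prod (Measure.pi fun _ => μ)) := by
      rw [← hmp.integral_comp (MeasurableEquiv.measurableEmbedding _)]
      refine integral_congr_ae (Filter.Eventually.of_forall fun ω => ?_)
      simp [Fin.sum_univ_succ, MeasurableEquiv.piFinSuccAbove, Fin.tail]
    have hmeas : Measurable fun p : Ω × (Fin n → Ω) => X p.1 + ∑ j, X (p.2 j) :=
      (hX.comp measurable_fst).add ((hsum n).comp measurable_snd)
    have hint : Integrable (fun p : Ω × (Fin n → Ω) => cosh ‖X p.1 + ∑ j, X (p.2 j)‖)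
        (μ.prod (Measure.pi fun _ => μ)) :=
      integrable_cosh_norm_of_norm_le hmeas (C := B + n * B)
        fun p => (norm_add_le _ _).trans (add_le_add (hB _) (hbd n _))
    rw [heq, integral_prod_symm _ hint]
    calc ∫ ω : Fin n → Ω, ∫ x, cosh ‖X x + ∑ j, X (ω j)‖ ∂μ ∂(Measure.pi fun _ => μ)
        ≤ ∫ ω : Fin n → Ω, cosh ‖∑ j, X (ω j)‖ * exp (B ^ 2) ∂(Measure.pi fun _ => μ) := by
          refine integral_mono hint.integral_prod_right ?_ fun ω => ?_
          · exact (integrable_cosh_norm_of_norm_le (hsum n) (hbd n)).mul_const _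
          · exact integral_cosh_norm_add_le hX hB h0 _
      _ ≤ exp (n * B ^ 2) * exp (B ^ 2) := by
          rw [integral_mul_const]; gcongr
      _ = exp ((n + 1 : ℕ) * B ^ 2) := by rw [← exp_add]; push_cast; ring_nf

/-- Dimension-free Hoeffding inequality for the mean of i.i.d. bounded Hilbert-space-valued
random variables. -/
theorem measureReal_norm_mean_sub_integral_gt_le {X : Ω → E} (hX : Measurable X) {B : ℝ}
    (hB0 : 0 < B) (hB : ∀ ω, ‖X ω‖ ≤ B) {n : ℕ} (hn : 0 < n) {a : ℝ} (ha : 0 < a) :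
    (Measure.pi fun _ : Fin n => μ).real
      {ω | a < ‖(n : ℝ)⁻¹ • ∑ j, X (ω j) - ∫ x, X x ∂μ‖} ≤
      2 * exp (-(n * a ^ 2 / (16 * B ^ 2))) := by
  have hn' : (0 : ℝ) < n := by exact_mod_cast hn
  set e := ∫ x, X x ∂μ with he
  have hXi : Integrable X μ := Integrable.of_bound (C := B) hX.aestronglyMeasurable
    (Filter.Eventually.of_forall hB)
  have heB : ‖e‖ ≤ B := by
    simpa using norm_integral_le_of_norm_le_const (μ := μ) (Filter.Eventually.of_forall hB)
  -- The centred variables have norm at most `2 B`, so the exponent after Markov's inequality is `n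
  -- (4 l ^ 2 B ^ 2 - l a)`; this `l` minimises it. The prefactor 2 comes from `cosh y ≥ exp y / 2`.
  set l : ℝ := a / (8 * B ^ 2) with hl
  have hl0 : 0 < l := by positivity
  have hY : Measurable fun ω => l • (X ω - e) := (hX.sub_const e).const_smul l
  have hYB : ∀ ω, ‖l • (X ω - e)‖ ≤ l * (2 * B) := fun ω => by
    rw [norm_smul, Real.norm_of_nonneg hl0.le]
    gcongr
    exact (norm_sub_le _ _).trans (by linarith [hB ω])
  have hY0 : ∫ ω, l • (X ω - e) ∂μ = 0 := by
    rw [integral_smul, integral_sub hXi (integrable_const _)]; simp [he]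
  have hmain := integral_cosh_norm_sum_le hY hYB hY0 n
  have hint : Integrable (fun ω : Fin n → Ω => cosh ‖∑ j, l • (X (ω j) - e)‖)
      (Measure.pi fun _ => μ) :=
    integrable_cosh_norm_of_norm_le
      (Finset.measurable_sum _ fun j _ => hY.comp (measurable_pi_apply j)) (C := n * (l * (2 * B)))
      fun ω => (norm_sum_le _ _).trans ((Finset.sum_le_sum fun j _ => hYB (ω j)).trans_eq (by simp))
  have hmk := mul_meas_ge_le_integral_of_nonneg (μ := Measure.pi fun _ : Fin n => μ)
    (Filter.Eventually.of_forall fun ω => (cosh_pos _).le) hint (exp (n * l * a) / 2)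
  have hsub : {ω : Fin n → Ω | a < ‖(n : ℝ)⁻¹ • ∑ j, X (ω j) - e‖} ⊆
      {ω | exp (n * l * a) / 2 ≤ cosh ‖∑ j, l • (X (ω j) - e)‖} := by
    intro ω hω
    simp only [Set.mem_ofPred_eq] at hω ⊢
    have h1 : ∑ j, l • (X (ω j) - e) = (n * l) • ((n : ℝ)⁻¹ • ∑ j, X (ω j) - e) := by
      rw [← Finset.smul_sum, Finset.sum_sub_distrib, smul_sub, smul_sub (_ * l),
        smul_smul, show (n : ℝ) * l * (n : ℝ)⁻¹ = l by field_simp]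
      simp [mul_smul, smul_comm l, ← Nat.cast_smul_eq_nsmul ℝ]
    rw [h1, norm_smul, Real.norm_of_nonneg (by positivity), cosh_eq]
    have : exp (n * l * a) ≤ exp (n * l * ‖(n : ℝ)⁻¹ • ∑ j, X (ω j) - e‖) := by
      gcongr
    linarith [exp_pos (-(n * l * ‖(n : ℝ)⁻¹ • ∑ j, X (ω j) - e‖))]
  have h3 : (Measure.pi fun _ : Fin n => μ).real
      {ω | a < ‖(n : ℝ)⁻¹ • ∑ j, X (ω j) - e‖} ≤ (Measure.pi fun _ : Fin n => μ).real
      {ω | exp (n * l * a) / 2 ≤ cosh ‖∑ j, l • (X (ω j) - e)‖} := measureReal_mono hsub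
  have h4 : exp (n * l * a) / 2 * (Measure.pi fun _ : Fin n => μ).real
      {ω | a < ‖(n : ℝ)⁻¹ • ∑ j, X (ω j) - e‖} ≤ exp (n * (l * (2 * B)) ^ 2) :=
    ((mul_le_mul_of_nonneg_left h3 (by positivity)).trans hmk).trans hmain
  have h5 : exp (n * (l * (2 * B)) ^ 2) =
      exp (n * l * a) * exp (-(n * a ^ 2 / (16 * B ^ 2))) := by
    rw [← exp_add, hl]; congr 1; field_simp; ring
  rw [h5] at h4
  have h6 := exp_pos (n * l * a)
  refine le_of_mul_le_mul_left (a := exp (n * l * a)) ?_ h6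
  linarith

end Concentration

/-! ### Change of measure between trajectory laws. -/

section Trajectory

variable {S A : Type*} [MeasurableSpace S] [MeasurableSpace A] {m d : ℕ}

namespace PolicyFamily

theorem measurable_logDens (π : PolicyFamily S A d) (θ : EuclideanSpace ℝ (Fin d)) :
    Measurable fun x => π.logDens x θ :=
  Real.measurable_log.comp (π.measurable_dens θ)

/-- The likelihood ratio `π_θ'(a | s) / π_θ(a | s)`. -/
noncomputable def ratio (π : PolicyFamily S A d) (θ θ' : EuclideanSpace ℝ (Fin d)) (x : S × A) :
    ℝ :=
  Real.exp (π.logDens x θ' - π.logDens x θ)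

theorem ratio_pos (π : PolicyFamily S A d) (θ θ' : EuclideanSpace ℝ (Fin d)) (x : S × A) :
    0 < π.ratio θ θ' x := Real.exp_pos _

theorem measurable_ratio (π : PolicyFamily S A d) (θ θ' : EuclideanSpace ℝ (Fin d)) :
    Measurable (π.ratio θ θ') :=
  Real.measurable_exp.comp ((π.measurable_logDens θ').sub (π.measurable_logDens θ))

theorem dens_mul_ratio (π : PolicyFamily S A d) (θ θ' : EuclideanSpace ℝ (Fin d)) (x : S × A) :
    π.dens θ x.1 x.2 * π.ratio θ θ' x = π.dens θ' x.1 x.2 := by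
  have h := π.dens_pos θ x.1 x.2
  rw [ratio, logDens, logDens, Real.exp_sub, Real.exp_log h, Real.exp_log (π.dens_pos _ _ _)]
  field_simp

theorem lintegral_kernel_eq (π : PolicyFamily S A d) (θ θ' : EuclideanSpace ℝ (Fin d)) (s : S)
    {f : A → ENNReal} (hf : Measurable f) :
    ∫⁻ a, f a ∂(π.kernel θ' s) =
      ∫⁻ a, ENNReal.ofReal (π.ratio θ θ' (s, a)) * f a ∂(π.kernel θ s) := by
  have hm : ∀ θ, Measurable (Function.uncurry fun s a => ENNReal.ofReal (π.dens θ s a)) :=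
    fun θ => (π.measurable_dens θ).ennreal_ofReal
  have hr : Measurable fun a => ENNReal.ofReal (π.ratio θ θ' (s, a)) :=
    ((π.measurable_ratio θ θ').comp measurable_prodMk_left).ennreal_ofReal
  rw [kernel, kernel, Kernel.lintegral_withDensity _ (hm θ') s hf,
    Kernel.lintegral_withDensity _ (hm θ) s (hr.fun_mul hf)]
  refine lintegral_congr fun a => ?_
  rw [← mul_assoc, ← ENNReal.ofReal_mul (π.dens_pos _ _ _).le, π.dens_mul_ratio θ θ' (s, a)]

end PolicyFamily

namespace CMDP

/-- The transition `P` does not depend on the parameter, so only the policy ratio at the new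
state-action pair remains. -/
theorem lintegral_stepKernel_eq (M : CMDP S A m) (π : PolicyFamily S A d)
    (θ θ' : EuclideanSpace ℝ (Fin d)) (x : S × A) {f : S × A → ENNReal} (hf : Measurable f) :
    ∫⁻ y, f y ∂(M.stepKernel π θ' x) =
      ∫⁻ y, ENNReal.ofReal (π.ratio θ θ' y) * f y ∂(M.stepKernel π θ x) := by
  have hr := (π.measurable_ratio θ θ').ennreal_ofReal
  rw [stepKernel, stepKernel, Kernel.lintegral_compProd _ _ _ hf,
    Kernel.lintegral_compProd _ _ _ (hr.fun_mul hf)]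
  refine lintegral_congr fun s => ?_
  simp only [Kernel.prodMkLeft_apply]
  exact π.lintegral_kernel_eq θ θ' s (hf.comp measurable_prodMk_left)

theorem lintegral_initial_eq (M : CMDP S A m) (π : PolicyFamily S A d)
    (θ θ' : EuclideanSpace ℝ (Fin d)) {f : S × A → ENNReal} (hf : Measurable f) :
    ∫⁻ y, f y ∂(M.ρ.compProd (π.kernel θ')) =
      ∫⁻ y, ENNReal.ofReal (π.ratio θ θ' y) * f y ∂(M.ρ.compProd (π.kernel θ)) := by
  have hr := (π.measurable_ratio θ θ').ennreal_ofReal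
  rw [Measure.lintegral_compProd hf, Measure.lintegral_compProd (hr.fun_mul hf)]
  exact lintegral_congr fun s => π.lintegral_kernel_eq θ θ' s (hf.comp measurable_prodMk_left)

end CMDP

/-- The trajectory that follows `τ` up to time `T` and is constantly `x` afterwards. -/
def stopAt {X : Type*} (T : ℕ) (τ : ℕ → X) (x : X) : ℕ → X := fun t => if t ≤ T then τ t else x

theorem measurable_stopAt {X : Type*} [MeasurableSpace X] (T : ℕ) :
    Measurable fun p : (ℕ → X) × X => stopAt T p.1 p.2 := by
  refine measurable_pi_lambda _ fun t => ?_
  unfold stopAt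
  split_ifs
  · exact (measurable_pi_apply t).comp measurable_fst
  · exact measurable_snd

namespace CMDP

theorem map_eval_zero_trajLaw (M : CMDP S A m) (π : PolicyFamily S A d)
    (θ : EuclideanSpace ℝ (Fin d)) :
    (M.trajLaw π θ).map (fun τ => τ 0) = M.ρ.compProd (π.kernel θ) := by
  have h1 : (fun τ : ℕ → S × A => τ 0) =
      (MeasurableEquiv.piUnique (fun _ : Finset.Iic 0 => S × A)) ∘
        (Preorder.frestrictLe (π := fun _ => S × A) 0) := by
    ext τ <;> rfl
  rw [trajLaw, Kernel.trajMeasure, h1, ← Measure.map_map (by fun_prop) (by fun_prop),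
    Measure.map_comp _ _ (by fun_prop), Kernel.traj_map_frestrictLe, Kernel.partialTraj_self,
    Measure.id_comp, Measure.map_map (by fun_prop) (by fun_prop)]
  have : (MeasurableEquiv.piUnique (fun _ : Finset.Iic 0 => S × A)) ∘
    (MeasurableEquiv.piUnique (fun _ : Finset.Iic 0 => S × A)).symm = id := by
      ext x : 1; simp
  exact (congrArg (fun g => Measure.map g (M.ρ.compProd (π.kernel θ))) this).trans Measure.map_id

theorem lintegral_trajLaw_succ (M : CMDP S A m) (π : PolicyFamily S A d)
    (θ : EuclideanSpace ℝ (Fin d)) (T : ℕ) {f : (ℕ → S × A) → ENNReal} (hf : Measurable f)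
    (hfT : DependsOn f (Set.Iic (T + 1))) :
    ∫⁻ τ, f τ ∂(M.trajLaw π θ) =
      ∫⁻ τ, ∫⁻ x, f (stopAt T τ x) ∂(M.stepKernel π θ (τ T)) ∂(M.trajLaw π θ) := by
  -- Rebuilds a trajectory from its history and its next step. The repeated value after time `T + 1`
  -- is an arbitrary filler that `f` does not see.
  let e : (Finset.Iic T → S × A) × (S × A) → ℕ → S × A :=
    fun p t => if h : t ≤ T then p.1 ⟨t, Finset.mem_Iic.2 h⟩ else p.2
  have he : Measurable e := by
    refine measurable_pi_lambda _ fun t => ?_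
    by_cases h : t ≤ T
    · simp only [e, h, dif_pos]; exact (measurable_pi_apply _).comp measurable_fst
    · simp only [e, h]; exact measurable_snd
  have hes : ∀ (τ : ℕ → S × A) x, e (Preorder.frestrictLe T τ, x) = stopAt T τ x := by
    intro τ x; ext t : 1
    by_cases h : t ≤ T <;> simp [e, stopAt, h]
  have hfe : ∀ τ, f τ = f (e (Preorder.frestrictLe T τ, τ (T + 1))) := by
    intro τ
    refine hfT fun t ht => ?_
    rw [hes, stopAt]
    split_ifs with h
    · rfl
    · rw [show t = T + 1 from le_antisymm ht (by omega)]
  have hfem : Measurable fun p => f (e p) := hf.comp he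
  have hmap := Kernel.map_frestrictLe_trajMeasure_compProd_eq_map_trajMeasure
    (X := fun _ => S × A) (μ₀ := M.ρ.compProd (π.kernel θ)) (κ := M.historyKernel π θ) (a := T)
  calc ∫⁻ τ, f τ ∂(M.trajLaw π θ)
      = ∫⁻ τ, f (e (Preorder.frestrictLe T τ, τ (T + 1))) ∂(M.trajLaw π θ) :=
        lintegral_congr hfe
    _ = ∫⁻ p, f (e p) ∂((M.trajLaw π θ).map
          (fun τ => (Preorder.frestrictLe (π := fun _ => S × A) T τ, τ (T + 1)))) := by
        rw [lintegral_map hfem (by fun_prop)]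
    _ = ∫⁻ p, f (e p) ∂(((M.trajLaw π θ).map
          (Preorder.frestrictLe (π := fun _ => S × A) T)).compProd (M.historyKernel π θ T)) := by
        rw [trajLaw, hmap]
    _ = ∫⁻ h, ∫⁻ x, f (e (h, x)) ∂(M.historyKernel π θ T h)
          ∂((M.trajLaw π θ).map (Preorder.frestrictLe (π := fun _ => S × A) T)) := by
        rw [Measure.lintegral_compProd hfem]
    _ = _ := by
        rw [lintegral_map (Measurable.lintegral_kernel_prod_right' hfem) (by fun_prop)]
        refine lintegral_congr fun τ => ?_
        simp only [hes]
        rfl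

end CMDP

/-- The likelihood ratio of the trajectory up to time `T`. -/
noncomputable def PolicyFamily.trajRatio (π : PolicyFamily S A d)
    (θ θ' : EuclideanSpace ℝ (Fin d)) (T : ℕ) (τ : ℕ → S × A) : ℝ :=
  ∏ t ∈ Finset.range (T + 1), π.ratio θ θ' (τ t)

namespace PolicyFamily

theorem trajRatio_pos (π : PolicyFamily S A d) (θ θ' : EuclideanSpace ℝ (Fin d)) (T : ℕ)
    (τ : ℕ → S × A) : 0 < π.trajRatio θ θ' T τ :=
  Finset.prod_pos fun _ _ => π.ratio_pos _ _ _

theorem measurable_trajRatio (π : PolicyFamily S A d) (θ θ' : EuclideanSpace ℝ (Fin d)) (T : ℕ) :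
    Measurable (π.trajRatio θ θ' T) :=
  Finset.measurable_prod _ fun t _ => (π.measurable_ratio θ θ').comp (measurable_pi_apply t)

theorem trajRatio_stopAt (π : PolicyFamily S A d) (θ θ' : EuclideanSpace ℝ (Fin d)) (T : ℕ)
    (τ : ℕ → S × A) (x : S × A) :
    π.trajRatio θ θ' (T + 1) (stopAt T τ x) = π.trajRatio θ θ' T τ * π.ratio θ θ' x := by
  rw [trajRatio, Finset.prod_range_succ, trajRatio]
  congr 1
  · refine Finset.prod_congr rfl fun t ht => ?_
    rw [stopAt, if_pos (Nat.lt_succ_iff.1 (Finset.mem_range.1 ht))]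
  · simp [stopAt]

theorem dependsOn_trajRatio (π : PolicyFamily S A d) (θ θ' : EuclideanSpace ℝ (Fin d)) (T : ℕ) :
    DependsOn (π.trajRatio θ θ' T) (Set.Iic T) := fun τ τ' h =>
  Finset.prod_congr rfl fun t ht => by
    rw [h t (Nat.lt_succ_iff.1 (Finset.mem_range.1 ht))]

end PolicyFamily

namespace CMDP

/-- Change of measure for the trajectory up to time `T`. -/
theorem lintegral_trajLaw_eq (M : CMDP S A m) (π : PolicyFamily S A d)
    (θ θ' : EuclideanSpace ℝ (Fin d)) (T : ℕ) {f : (ℕ → S × A) → ENNReal} (hf : Measurable f)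
    (hfT : DependsOn f (Set.Iic T)) :
    ∫⁻ τ, f τ ∂(M.trajLaw π θ') =
      ∫⁻ τ, ENNReal.ofReal (π.trajRatio θ θ' T τ) * f τ ∂(M.trajLaw π θ) := by
  induction T generalizing f with
  | zero =>
    have hc : Measurable fun (x : S × A) (_ : ℕ) => x := by fun_prop
    have h0 : ∀ τ, f τ = f (fun _ => τ 0) := fun τ => hfT fun t ht => by
      rw [Nat.le_zero.1 ht]
    have hfc : Measurable fun x : S × A => f (fun _ => x) := hf.comp hc
    have hr := (π.measurable_ratio θ θ').ennreal_ofReal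
    have key : ∀ (θ : EuclideanSpace ℝ (Fin d)) {g : S × A → ENNReal}, Measurable g →
        ∫⁻ τ, g (τ 0) ∂(M.trajLaw π θ) = ∫⁻ x, g x ∂(M.ρ.compProd (π.kernel θ)) := by
      intro θ g hg
      rw [← M.map_eval_zero_trajLaw π θ, lintegral_map hg (measurable_pi_apply 0)]
    rw [lintegral_congr h0, key θ' hfc, M.lintegral_initial_eq π θ θ' hfc, ← key θ (hr.fun_mul hfc)]
    refine lintegral_congr fun τ => ?_
    rw [h0 τ]
    simp [PolicyFamily.trajRatio]
  | succ T ih =>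
    have hL : Measurable fun τ => ENNReal.ofReal (π.trajRatio θ θ' (T + 1) τ) :=
      (π.measurable_trajRatio θ θ' (T + 1)).ennreal_ofReal
    have hfs : ∀ τ, Measurable fun x => f (stopAt T τ x) := fun τ =>
      hf.comp ((measurable_stopAt T).comp measurable_prodMk_left)
    have hr := (π.measurable_ratio θ θ').ennreal_ofReal
    rw [M.lintegral_trajLaw_succ π θ' T hf hfT, M.lintegral_trajLaw_succ π θ T (hL.fun_mul hf)]
    -- Averaging out the last step under `θ'` leaves a function of the history up to `T`, to which
    -- the induction hypothesis applies; the last step then contributes the remaining factor of the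
    -- likelihood ratio.
    · let g : (ℕ → S × A) → ENNReal := fun τ =>
        ∫⁻ x, f (stopAt T τ x) ∂(M.stepKernel π θ' (τ T))
      have hg : Measurable g := by
        have : Measurable fun p : (ℕ → S × A) × (S × A) => f (stopAt T p.1 p.2) :=
          hf.comp (measurable_stopAt T)
        exact Measurable.lintegral_kernel_prod_right'
          (κ := (M.stepKernel π θ').comap (fun τ : ℕ → S × A => τ T) (measurable_pi_apply T)) this
      have hgT : DependsOn g (Set.Iic T) := fun τ τ' h => by
        have h1 : ∀ x, stopAt T τ x = stopAt T τ' x := fun x => by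
          ext t : 1
          by_cases ht : t ≤ T
          · simp [stopAt, ht, h t ht]
          · simp [stopAt, ht]
        simp only [g, h1, h T (Set.mem_Iic.2 le_rfl)]
      rw [ih hg hgT]
      refine lintegral_congr fun τ => ?_
      simp only [g]
      rw [M.lintegral_stepKernel_eq π θ θ' (τ T) (hfs τ),
        ← lintegral_const_mul _ (hr.fun_mul (hfs τ))]
      refine lintegral_congr fun x => ?_
      rw [π.trajRatio_stopAt, ENNReal.ofReal_mul (π.trajRatio_pos _ _ _ _).le, mul_assoc]
    · intro τ τ' h
      simp only [hfT h, π.dependsOn_trajRatio θ θ' (T + 1) h]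

theorem lintegral_trajRatio (M : CMDP S A m) (π : PolicyFamily S A d)
    (θ θ' : EuclideanSpace ℝ (Fin d)) (T : ℕ) :
    ∫⁻ τ, ENNReal.ofReal (π.trajRatio θ θ' T τ) ∂(M.trajLaw π θ) = 1 := by
  have := M.lintegral_trajLaw_eq π θ θ' T (f := fun _ => 1) measurable_const (fun _ _ _ => rfl)
  simpa using this.symm

theorem integrable_trajRatio (M : CMDP S A m) (π : PolicyFamily S A d)
    (θ θ' : EuclideanSpace ℝ (Fin d)) (T : ℕ) :
    Integrable (π.trajRatio θ θ' T) (M.trajLaw π θ) := by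
  refine ⟨(π.measurable_trajRatio θ θ' T).aestronglyMeasurable, ?_⟩
  rw [hasFiniteIntegral_iff_ofReal
    (Filter.Eventually.of_forall fun τ => (π.trajRatio_pos _ _ _ _).le), M.lintegral_trajRatio]
  exact ENNReal.one_lt_top

theorem integral_trajRatio (M : CMDP S A m) (π : PolicyFamily S A d)
    (θ θ' : EuclideanSpace ℝ (Fin d)) (T : ℕ) :
    ∫ τ, π.trajRatio θ θ' T τ ∂(M.trajLaw π θ) = 1 := by
  rw [integral_eq_lintegral_of_nonneg_ae
    (Filter.Eventually.of_forall fun τ => (π.trajRatio_pos _ _ _ _).le)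
    (π.measurable_trajRatio θ θ' T).aestronglyMeasurable, M.lintegral_trajRatio, ENNReal.toReal_one]

theorem integral_eval_trajLaw_eq (M : CMDP S A m) (π : PolicyFamily S A d)
    (θ θ' : EuclideanSpace ℝ (Fin d)) (T : ℕ) {g : S × A → ℝ} (hg : Measurable g) {C : ℝ}
    (hC : ∀ x, |g x| ≤ C) :
    ∫ τ, g (τ T) ∂(M.trajLaw π θ') =
      ∫ τ, π.trajRatio θ θ' T τ * g (τ T) ∂(M.trajLaw π θ) := by
  have hgT : Measurable fun τ : ℕ → S × A => g (τ T) := hg.comp (measurable_pi_apply T)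
  -- The change of measure is available for nonnegative functions; the shift by `C` is removed at
  -- the end because the likelihood ratio integrates to 1.
  have hnn : ∀ x, 0 ≤ g x + C := fun x => by linarith [(abs_le.1 (hC x)).1]
  have hint : Integrable (fun τ : ℕ → S × A => g (τ T)) (M.trajLaw π θ') :=
    Integrable.of_bound (C := C) hgT.aestronglyMeasurable
      (Filter.Eventually.of_forall fun τ => hC _)
  have hLi := M.integrable_trajRatio π θ θ' T
  have hLg : Integrable (fun τ => π.trajRatio θ θ' T τ * g (τ T)) (M.trajLaw π θ) :=
    hLi.mul_bdd (c := C) hgT.aestronglyMeasurable (Filter.Eventually.of_forall fun τ => hC _)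
  have h1 : ∫ τ, (g (τ T) + C) ∂(M.trajLaw π θ') =
      ∫ τ, π.trajRatio θ θ' T τ * (g (τ T) + C) ∂(M.trajLaw π θ) := by
    rw [integral_eq_lintegral_of_nonneg_ae (Filter.Eventually.of_forall fun τ => hnn _)
        (hgT.add_const C).aestronglyMeasurable,
      integral_eq_lintegral_of_nonneg_ae
        (Filter.Eventually.of_forall fun τ => mul_nonneg (π.trajRatio_pos _ _ _ _).le (hnn _))
        ((π.measurable_trajRatio θ θ' T).mul (hgT.add_const C)).aestronglyMeasurable,
      M.lintegral_trajLaw_eq π θ θ' T (hgT.add_const C).ennreal_ofReal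
        (fun τ τ' h => by rw [h T (Set.mem_Iic.2 le_rfl)])]
    congr 1
    exact lintegral_congr fun τ => (ENNReal.ofReal_mul (π.trajRatio_pos _ _ _ _).le).symm
  simp only [mul_add] at h1
  rw [integral_add hint (integrable_const _), integral_add hLg (hLi.mul_const _),
    integral_mul_const, M.integral_trajRatio] at h1
  simpa using h1

end CMDP

end Trajectory

/-! ### Continuity of the values and the policy gradient theorem. -/

section PolicyGradient

open Filter Topology InnerProductSpace

variable {S A : Type*} [MeasurableSpace S] [MeasurableSpace A] {m d : ℕ}

namespace CMDP

theorem abs_r_le (M : CMDP S A m) (i : Fin (m + 1)) (x : S × A) : |M.r i x| ≤ 1 :=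
  abs_le.2 (M.r_mem i x)

theorem measurable_r_eval (M : CMDP S A m) (i : Fin (m + 1)) (t : ℕ) :
    Measurable fun τ : ℕ → S × A => M.r i (τ t) :=
  (M.measurable_r i).comp (measurable_pi_apply t)

/-- The expected reward `𝔼[r_i(s_t, a_t)]` at time `t`. -/
noncomputable def stepValue (M : CMDP S A m) (π : PolicyFamily S A d) (i : Fin (m + 1)) (t : ℕ)
    (θ : EuclideanSpace ℝ (Fin d)) : ℝ :=
  ∫ τ, M.r i (τ t) ∂(M.trajLaw π θ)

theorem abs_stepValue_le (M : CMDP S A m) (π : PolicyFamily S A d) (i : Fin (m + 1)) (t : ℕ)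
    (θ : EuclideanSpace ℝ (Fin d)) : |M.stepValue π i t θ| ≤ 1 := by
  have := norm_integral_le_of_norm_le_const (μ := M.trajLaw π θ) (f := fun τ => M.r i (τ t))
    (Eventually.of_forall fun τ => M.abs_r_le i (τ t))
  simpa [stepValue] using this

theorem integrable_r_eval (M : CMDP S A m) (π : PolicyFamily S A d) (i : Fin (m + 1)) (t : ℕ)
    (θ : EuclideanSpace ℝ (Fin d)) :
    Integrable (fun τ : ℕ → S × A => M.r i (τ t)) (M.trajLaw π θ) :=
  Integrable.of_bound (C := 1) (M.measurable_r_eval i t).aestronglyMeasurable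
    (Eventually.of_forall fun τ => M.abs_r_le i (τ t))

theorem summable_pow (M : CMDP S A m) : Summable fun t : ℕ => M.γ ^ t :=
  summable_geometric_of_lt_one M.γ_mem.1.le M.γ_mem.2

theorem norm_pow_mul_stepValue_le (M : CMDP S A m) (π : PolicyFamily S A d) (i : Fin (m + 1))
    (t : ℕ) (θ : EuclideanSpace ℝ (Fin d)) : ‖M.γ ^ t * M.stepValue π i t θ‖ ≤ M.γ ^ t := by
  have h := pow_nonneg M.γ_mem.1.le t
  rw [norm_mul, Real.norm_of_nonneg h]
  exact mul_le_of_le_one_right h (M.abs_stepValue_le π i t θ)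

theorem hasSum_value (M : CMDP S A m) (π : PolicyFamily S A d) (i : Fin (m + 1))
    (θ : EuclideanSpace ℝ (Fin d)) :
    HasSum (fun t => M.γ ^ t * M.stepValue π i t θ) (M.value π i θ) := by
  have h := hasSum_integral_of_summable_integral_norm (μ := M.trajLaw π θ)
    (F := fun (t : ℕ) τ => M.γ ^ t * M.r i (τ t))
    (fun t => (M.integrable_r_eval π i t θ).const_mul _) ?_
  · simpa only [integral_const_mul, stepValue, value] using h
  · refine Summable.of_nonneg_of_le (fun t => integral_nonneg fun _ => norm_nonneg _)
      (fun t => ?_) M.summable_pow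
    have hγ := pow_nonneg M.γ_mem.1.le t
    have := norm_integral_le_of_norm_le_const (μ := M.trajLaw π θ)
      (f := fun τ => ‖M.γ ^ t * M.r i (τ t)‖) (C := M.γ ^ t) (Eventually.of_forall fun τ => by
        rw [norm_norm, norm_mul, Real.norm_of_nonneg hγ]
        exact mul_le_of_le_one_right hγ (M.abs_r_le i (τ t)))
    simpa using (le_abs_self _).trans this

theorem value_eq_tsum (M : CMDP S A m) (π : PolicyFamily S A d) (i : Fin (m + 1)) :
    M.value π i = fun θ => ∑' t, M.γ ^ t * M.stepValue π i t θ :=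
  funext fun θ => (M.hasSum_value π i θ).tsum_eq.symm

theorem stepValue_eq_integral_trajRatio (M : CMDP S A m) (π : PolicyFamily S A d)
    (i : Fin (m + 1)) (t : ℕ) (θ θ' : EuclideanSpace ℝ (Fin d)) :
    M.stepValue π i t θ' = ∫ τ, π.trajRatio θ θ' t τ * M.r i (τ t) ∂(M.trajLaw π θ) :=
  M.integral_eval_trajLaw_eq π θ θ' t (M.measurable_r i) (M.abs_r_le i)

end CMDP

theorem PolicyFamily.trajRatio_self (π : PolicyFamily S A d) (θ : EuclideanSpace ℝ (Fin d))
    (T : ℕ) (τ : ℕ → S × A) : π.trajRatio θ θ T τ = 1 := by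
  simp [PolicyFamily.trajRatio, PolicyFamily.ratio]

theorem PolicyFamily.tendsto_trajRatio (π : PolicyFamily S A d)
    (hc : ∀ x, Continuous (π.logDens x)) (θ : EuclideanSpace ℝ (Fin d)) (T : ℕ)
    (τ : ℕ → S × A) : Tendsto (fun θ' => π.trajRatio θ θ' T τ) (𝓝 θ) (𝓝 1) := by
  have : Continuous fun θ' => π.trajRatio θ θ' T τ := by
    unfold PolicyFamily.trajRatio PolicyFamily.ratio
    have := fun t => hc (τ t)
    fun_prop
  simpa [π.trajRatio_self] using this.tendsto θ

namespace CMDP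

/-- The law of the trajectory up to a fixed time depends continuously on `θ` in total variation,
by Scheffé's argument. -/
theorem tendsto_integral_abs_trajRatio_sub_one (M : CMDP S A m) (π : PolicyFamily S A d)
    (hc : ∀ x, Continuous (π.logDens x)) (θ : EuclideanSpace ℝ (Fin d)) (T : ℕ) :
    Tendsto (fun θ' => ∫ τ, |π.trajRatio θ θ' T τ - 1| ∂(M.trajLaw π θ)) (𝓝 θ) (𝓝 0) := by
  have hmeas : ∀ θ', Measurable fun τ => min (π.trajRatio θ θ' T τ) 1 := fun θ' =>
    (π.measurable_trajRatio θ θ' T).min measurable_const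
  have hbd : ∀ θ' τ, ‖min (π.trajRatio θ θ' T τ) 1‖ ≤ 1 := fun θ' τ => by
    rw [Real.norm_of_nonneg (le_min (π.trajRatio_pos _ _ _ _).le zero_le_one)]
    exact min_le_right _ _
  have hmin : Tendsto (fun θ' => ∫ τ, min (π.trajRatio θ θ' T τ) 1 ∂(M.trajLaw π θ)) (𝓝 θ)
      (𝓝 1) := by
    have := tendsto_integral_filter_of_dominated_convergence (μ := M.trajLaw π θ) (l := 𝓝 θ)
      (F := fun θ' τ => min (π.trajRatio θ θ' T τ) 1) (f := fun _ => (1 : ℝ)) (fun _ => 1)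
      (Eventually.of_forall fun θ' => (hmeas θ').aestronglyMeasurable)
      (Eventually.of_forall fun θ' => Eventually.of_forall fun τ => hbd θ' τ)
      (integrable_const _) (Eventually.of_forall fun τ => by
        simpa using (π.tendsto_trajRatio hc θ T τ).min (tendsto_const_nhds (x := (1 : ℝ))))
    simpa using this
  have heq : ∀ θ', ∫ τ, |π.trajRatio θ θ' T τ - 1| ∂(M.trajLaw π θ) =
      2 - 2 * ∫ τ, min (π.trajRatio θ θ' T τ) 1 ∂(M.trajLaw π θ) := by
    intro θ'
    -- The unbounded part of `|L - 1| = L + 1 - 2 min(L, 1)` has the exact integral 2, so dominated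
    -- convergence is only needed for `min(L, 1)`, which is bounded by 1.
    have hpt : ∀ τ, |π.trajRatio θ θ' T τ - 1| =
        (π.trajRatio θ θ' T τ + 1) - 2 * min (π.trajRatio θ θ' T τ) 1 := fun τ => by
      rcases le_total (π.trajRatio θ θ' T τ) 1 with h | h
      · rw [min_eq_left h, abs_of_nonpos (by linarith)]; ring
      · rw [min_eq_right h, abs_of_nonneg (by linarith)]; ring
    have hi := M.integrable_trajRatio π θ θ' T
    have hmi : Integrable (fun τ => min (π.trajRatio θ θ' T τ) 1) (M.trajLaw π θ) :=
      Integrable.of_bound (C := 1) (hmeas θ').aestronglyMeasurable (Eventually.of_forall (hbd θ'))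
    have hi1 : Integrable (fun τ => π.trajRatio θ θ' T τ + 1) (M.trajLaw π θ) :=
      hi.add (integrable_const _)
    simp_rw [hpt]
    rw [integral_sub hi1 (hmi.const_mul 2),
      integral_add hi (integrable_const _), integral_const_mul, M.integral_trajRatio]
    simp
    norm_num
  simp_rw [heq]
  simpa using (hmin.const_mul 2).const_sub 2

theorem continuous_stepValue (M : CMDP S A m) (π : PolicyFamily S A d)
    (hc : ∀ x, Continuous (π.logDens x)) (i : Fin (m + 1)) (t : ℕ) :
    Continuous (M.stepValue π i t) := by
  refine continuous_iff_continuousAt.2 fun θ => ?_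
  rw [ContinuousAt, tendsto_iff_norm_sub_tendsto_zero]
  refine squeeze_zero (fun _ => norm_nonneg _) (fun θ' => ?_)
    (M.tendsto_integral_abs_trajRatio_sub_one π hc θ t)
  have hi := M.integrable_trajRatio π θ θ' t
  have hi1 : Integrable (fun τ => π.trajRatio θ θ' t τ - 1) (M.trajLaw π θ) :=
    hi.sub (integrable_const _)
  have h1 : Integrable (fun τ => π.trajRatio θ θ' t τ * M.r i (τ t)) (M.trajLaw π θ) :=
    hi.mul_bdd (c := 1) (M.measurable_r_eval i t).aestronglyMeasurable
      (Eventually.of_forall fun τ => M.abs_r_le i _)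
  have h2 : M.stepValue π i t θ' - M.stepValue π i t θ =
      ∫ τ, (π.trajRatio θ θ' t τ * M.r i (τ t) - M.r i (τ t)) ∂(M.trajLaw π θ) := by
    rw [integral_sub h1 (M.integrable_r_eval π i t θ),
      M.stepValue_eq_integral_trajRatio π i t θ θ', stepValue]
  rw [h2]
  refine (norm_integral_le_integral_norm _).trans (integral_mono
    (h1.sub (M.integrable_r_eval π i t θ)).norm hi1.abs fun τ => ?_)
  rw [← sub_one_mul, norm_mul, Real.norm_eq_abs, Real.norm_eq_abs]
  exact mul_le_of_le_one_right (abs_nonneg _) (M.abs_r_le i _)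

theorem continuous_value (M : CMDP S A m) (π : PolicyFamily S A d)
    (hc : ∀ x, Continuous (π.logDens x)) (i : Fin (m + 1)) : Continuous (M.value π i) := by
  rw [M.value_eq_tsum π i]
  exact continuous_tsum (fun t => continuous_const.mul (M.continuous_stepValue π hc i t))
    M.summable_pow fun t θ => M.norm_pow_mul_stepValue_le π i t θ

end CMDP

namespace PolicyFamily

/-- Measurability in `(s, a)` is assumed for the densities only. Each directional derivative
inherits it as a pointwise limit of difference quotients in `θ`. -/
theorem measurable_score (π : PolicyFamily S A d) (hd : ∀ x, Differentiable ℝ (π.logDens x))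
    (θ : EuclideanSpace ℝ (Fin d)) : Measurable fun x => π.score x θ := by
  have hin : ∀ v, Measurable fun x => inner ℝ (π.score x θ) v := by
    intro v
    have hlim : ∀ x, Tendsto (fun n : ℕ => ((n : ℝ) + 1) *
        (π.logDens x (θ + ((n : ℝ) + 1)⁻¹ • v) - π.logDens x θ)) atTop
        (𝓝 (inner ℝ (π.score x θ) v)) := fun x => by
      have h1 : HasFDerivAt (π.logDens x) (toDual ℝ _ (π.score x θ)) θ :=
        (hd x θ).hasGradientAt.hasFDerivAt
      have h2 := h1.lim v (c := fun n : ℕ => (n : ℝ) + 1) (l := atTop) (by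
        refine tendsto_atTop_mono (fun n => le_abs_self _) ?_
        exact tendsto_atTop_add_const_right _ _ tendsto_natCast_atTop_atTop)
      simpa using h2
    refine measurable_of_tendsto_metrizable (f := fun (n : ℕ) x => ((n : ℝ) + 1) *
      (π.logDens x (θ + ((n : ℝ) + 1)⁻¹ • v) - π.logDens x θ)) (fun n => ?_)
      (tendsto_pi_nhds.2 hlim)
    exact ((π.measurable_logDens _).sub (π.measurable_logDens _)).const_mul _
  have h3 : Measurable fun x => (fun k => π.score x θ k) := by
    refine measurable_pi_lambda _ fun k => ?_
    simpa [EuclideanSpace.inner_single_right] using hin (EuclideanSpace.single k 1)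
  exact (WithLp.measurable_toLp 2 _).comp h3

/-- The sum of the scores along the trajectory up to time `T`. -/
noncomputable def scoreSum (π : PolicyFamily S A d) (θ : EuclideanSpace ℝ (Fin d)) (T : ℕ)
    (τ : ℕ → S × A) : EuclideanSpace ℝ (Fin d) :=
  ∑ t ∈ Finset.range (T + 1), π.score (τ t) θ

theorem measurable_scoreSum (π : PolicyFamily S A d) (hd : ∀ x, Differentiable ℝ (π.logDens x))
    (θ : EuclideanSpace ℝ (Fin d)) (T : ℕ) : Measurable (π.scoreSum θ T) :=
  Finset.measurable_sum _ fun t _ => (π.measurable_score hd θ).comp (measurable_pi_apply t)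

theorem norm_scoreSum_le (π : PolicyFamily S A d) {θ : EuclideanSpace ℝ (Fin d)} {Mg : ℝ}
    (hg : ∀ x, ‖π.score x θ‖ ≤ Mg) (T : ℕ) (τ : ℕ → S × A) :
    ‖π.scoreSum θ T τ‖ ≤ (T + 1) * Mg :=
  (norm_sum_le _ _).trans ((Finset.sum_le_sum fun t _ => hg (τ t)).trans_eq (by simp))

theorem hasFDerivAt_trajRatio (π : PolicyFamily S A d)
    (hd : ∀ x, Differentiable ℝ (π.logDens x)) (θ θ' : EuclideanSpace ℝ (Fin d)) (T : ℕ)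
    (τ : ℕ → S × A) :
    HasFDerivAt (fun θ' => π.trajRatio θ θ' T τ)
      (toDual ℝ _ (π.trajRatio θ θ' T τ • π.scoreSum θ' T τ)) θ' := by
  have heq : ∀ θ', π.trajRatio θ θ' T τ =
      Real.exp (∑ t ∈ Finset.range (T + 1), (π.logDens (τ t) θ' - π.logDens (τ t) θ)) := fun θ' => by
    rw [Real.exp_sum]; rfl
  have h1 : ∀ t, HasFDerivAt (fun θ' => π.logDens (τ t) θ' - π.logDens (τ t) θ)
      (toDual ℝ _ (π.score (τ t) θ')) θ' := fun t =>
    ((hd (τ t) θ').hasGradientAt.hasFDerivAt).sub_const _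
  have h2 := (HasFDerivAt.fun_sum (u := Finset.range (T + 1)) fun t _ => h1 t).exp
  simp_rw [heq]
  convert! h2 using 1
  simp [scoreSum]

/-- By the mean value inequality on the ball, which is convex, the log-density is `Mg`-Lipschitz
there. -/
theorem ratio_le (π : PolicyFamily S A d) (hd : ∀ x, Differentiable ℝ (π.logDens x))
    {θ : EuclideanSpace ℝ (Fin d)} {R Mg : ℝ} (hMg : 0 ≤ Mg)
    (hg : ∀ θ' ∈ Metric.ball θ R, ∀ x, ‖π.score x θ'‖ ≤ Mg) {θ' : EuclideanSpace ℝ (Fin d)}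
    (hθ' : θ' ∈ Metric.ball θ R) (x : S × A) : π.ratio θ θ' x ≤ Real.exp (Mg * R) := by
  have hR : 0 < R := Metric.pos_of_mem_ball hθ'
  have h := (convex_ball θ R).norm_image_sub_le_of_norm_fderiv_le (𝕜 := ℝ) (f := π.logDens x)
    (C := Mg) (fun y _ => hd x y) (fun y hy => ?_) (Metric.mem_ball_self hR) hθ'
  · refine Real.exp_le_exp.2 ((le_abs_self _).trans (h.trans ?_))
    gcongr
    exact (mem_ball_iff_norm.1 hθ').le
  · rw [← toDual_gradient, LinearIsometryEquiv.norm_map]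
    exact hg y hy x

theorem trajRatio_le (π : PolicyFamily S A d) (hd : ∀ x, Differentiable ℝ (π.logDens x))
    {θ : EuclideanSpace ℝ (Fin d)} {R Mg : ℝ} (hMg : 0 ≤ Mg)
    (hg : ∀ θ' ∈ Metric.ball θ R, ∀ x, ‖π.score x θ'‖ ≤ Mg) {θ' : EuclideanSpace ℝ (Fin d)}
    (hθ' : θ' ∈ Metric.ball θ R) (T : ℕ) (τ : ℕ → S × A) :
    π.trajRatio θ θ' T τ ≤ Real.exp (Mg * R) ^ (T + 1) := by
  refine (Finset.prod_le_prod (fun t _ => (π.ratio_pos _ _ _).le)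
    fun t _ => π.ratio_le hd hMg hg hθ' (τ t)).trans_eq ?_
  simp

end PolicyFamily

/-- Differentiation under the integral sign, in terms of gradients. -/
theorem hasGradientAt_integral_of_dominated {Ω E : Type*} [MeasurableSpace Ω]
    [NormedAddCommGroup E] [InnerProductSpace ℝ E] [CompleteSpace E] {μ : Measure Ω} {F : E → Ω → ℝ}
    {G : E → Ω → E} {bound : Ω → ℝ} {s : Set E} {x₀ : E} (hs : s ∈ 𝓝 x₀)
    (hF : ∀ x, AEStronglyMeasurable (F x) μ) (hFi : Integrable (F x₀) μ)
    (hG : AEStronglyMeasurable (G x₀) μ) (hb : ∀ ω, ∀ x ∈ s, ‖G x ω‖ ≤ bound ω)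
    (hbi : Integrable bound μ) (hd : ∀ ω, ∀ x ∈ s, HasGradientAt (F · ω) (G x ω) x) :
    HasGradientAt (fun x => ∫ ω, F x ω ∂μ) (∫ ω, G x₀ ω ∂μ) x₀ := by
  have hx₀ := mem_of_mem_nhds hs
  have hGi : Integrable (G x₀) μ := hbi.mono' hG (Eventually.of_forall fun ω => hb ω x₀ hx₀)
  have hG' : AEStronglyMeasurable (fun ω => toDual ℝ E (G x₀ ω)) μ :=
    (toDual ℝ E).continuous.comp_aestronglyMeasurable hG
  have hb' : ∀ ω, ∀ x ∈ s, ‖toDual ℝ E (G x ω)‖ ≤ bound ω := fun ω x hx => by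
    rw [LinearIsometryEquiv.norm_map]; exact hb ω x hx
  have h := hasFDerivAt_integral_of_dominated_of_fderiv_le (μ := μ) (bound := bound) (F := F)
    (F' := fun x ω => toDual ℝ E (G x ω)) hs (Eventually.of_forall hF) hFi hG'
    (Eventually.of_forall hb') hbi (Eventually.of_forall fun ω x hx => (hd ω x hx).hasFDerivAt)
  rw [hasGradientAt_iff_hasFDerivAt]
  convert! h using 1
  ext v
  rw [ContinuousLinearMap.integral_apply
    (hbi.mono' hG' (Eventually.of_forall fun ω => hb' ω x₀ hx₀))]
  simp only [toDual_apply_apply]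
  simp_rw [real_inner_comm v]
  exact (integral_inner hGi v).symm

/-- Termwise differentiation of a series, in terms of gradients. -/
theorem hasGradientAt_tsum_of_ball {E : Type*} [NormedAddCommGroup E] [InnerProductSpace ℝ E]
    [CompleteSpace E] {f : ℕ → E → ℝ} {g : ℕ → E → E} {u : ℕ → ℝ} {x₀ : E} {R : ℝ} (hR : 0 < R)
    (hu : Summable u) (hf : ∀ n, ∀ x ∈ Metric.ball x₀ R, HasGradientAt (f n) (g n x) x)
    (hg : ∀ n, ∀ x ∈ Metric.ball x₀ R, ‖g n x‖ ≤ u n) (hf0 : Summable fun n => f n x₀) :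
    HasGradientAt (fun x => ∑' n, f n x) (∑' n, g n x₀) x₀ := by
  have hx₀ := Metric.mem_ball_self (x := x₀) hR
  have h := hasFDerivAt_tsum_of_isPreconnected hu Metric.isOpen_ball
    (convex_ball x₀ R).isPreconnected (f := f) (f' := fun n x => toDual ℝ E (g n x))
    (fun n x hx => (hf n x hx).hasFDerivAt)
    (fun n x hx => by rw [LinearIsometryEquiv.norm_map]; exact hg n x hx) hx₀ hf0 hx₀
  rw [hasGradientAt_iff_hasFDerivAt]
  convert! h using 1
  have hs : Summable fun n => g n x₀ := Summable.of_norm_bounded hu fun n => hg n x₀ hx₀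
  exact (hs.hasSum.map (toDual ℝ E) (toDual ℝ E).continuous).tsum_eq.symm

namespace CMDP

/-- The policy-gradient expression for the gradient of `𝔼[r_i(s_t, a_t)]`. -/
noncomputable def stepGrad (M : CMDP S A m) (π : PolicyFamily S A d) (i : Fin (m + 1)) (t : ℕ)
    (θ : EuclideanSpace ℝ (Fin d)) : EuclideanSpace ℝ (Fin d) :=
  ∫ τ, M.r i (τ t) • π.scoreSum θ t τ ∂(M.trajLaw π θ)

theorem integrable_r_smul_scoreSum (M : CMDP S A m) (π : PolicyFamily S A d)
    (hd : ∀ x, Differentiable ℝ (π.logDens x)) {θ : EuclideanSpace ℝ (Fin d)} {Mg : ℝ}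
    (hg : ∀ x, ‖π.score x θ‖ ≤ Mg) (i : Fin (m + 1)) (t : ℕ) :
    Integrable (fun τ => M.r i (τ t) • π.scoreSum θ t τ) (M.trajLaw π θ) := by
  refine Integrable.of_bound (C := (t + 1) * Mg)
    ((M.measurable_r_eval i t).smul (π.measurable_scoreSum hd θ t)).aestronglyMeasurable
    (Eventually.of_forall fun τ => ?_)
  rw [norm_smul]
  exact (mul_le_of_le_one_left (norm_nonneg _) (M.abs_r_le i _)).trans (π.norm_scoreSum_le hg t τ)

theorem norm_stepGrad_le (M : CMDP S A m) (π : PolicyFamily S A d)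
    {θ : EuclideanSpace ℝ (Fin d)} {Mg : ℝ} (hg : ∀ x, ‖π.score x θ‖ ≤ Mg) (i : Fin (m + 1))
    (t : ℕ) : ‖M.stepGrad π i t θ‖ ≤ (t + 1) * Mg := by
  have := norm_integral_le_of_norm_le_const (μ := M.trajLaw π θ) (C := (t + 1) * Mg)
    (f := fun τ => M.r i (τ t) • π.scoreSum θ t τ) (Eventually.of_forall fun τ => by
      rw [norm_smul]
      exact (mul_le_of_le_one_left (norm_nonneg _) (M.abs_r_le i _)).trans
        (π.norm_scoreSum_le hg t τ))
  simpa [stepGrad] using this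

/-- After the change of measure to the fixed law at `θ`, only the likelihood ratio depends on the
parameter. Its gradient is the ratio times the summed scores, bounded by a constant on the ball, and
at `θ` itself the ratio is 1. -/
theorem hasGradientAt_stepValue (M : CMDP S A m) (π : PolicyFamily S A d)
    (hd : ∀ x, Differentiable ℝ (π.logDens x)) {θ : EuclideanSpace ℝ (Fin d)} {R Mg : ℝ}
    (hMg : 0 ≤ Mg) (hR : 0 < R) (hg : ∀ θ' ∈ Metric.ball θ R, ∀ x, ‖π.score x θ'‖ ≤ Mg)
    (i : Fin (m + 1)) (t : ℕ) : HasGradientAt (M.stepValue π i t) (M.stepGrad π i t θ) θ := by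
  have heq : M.stepValue π i t =
      fun θ' => ∫ τ, π.trajRatio θ θ' t τ * M.r i (τ t) ∂(M.trajLaw π θ) :=
    funext fun θ' => M.stepValue_eq_integral_trajRatio π i t θ θ'
  have hr := M.measurable_r_eval i t
  have h := hasGradientAt_integral_of_dominated (μ := M.trajLaw π θ)
    (F := fun θ' τ => π.trajRatio θ θ' t τ * M.r i (τ t))
    (G := fun θ' τ => M.r i (τ t) • (π.trajRatio θ θ' t τ • π.scoreSum θ' t τ))
    (bound := fun _ => Real.exp (Mg * R) ^ (t + 1) * ((t + 1) * Mg))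
    (Metric.ball_mem_nhds θ hR)
    (fun θ' => ((π.measurable_trajRatio θ θ' t).mul hr).aestronglyMeasurable)
    (by simpa only [π.trajRatio_self, one_mul] using M.integrable_r_eval π i t θ)
    (hr.smul ((π.measurable_trajRatio θ θ t).smul
      (π.measurable_scoreSum hd θ t))).aestronglyMeasurable
    (fun τ θ' hθ' => ?_) (integrable_const _) (fun τ θ' hθ' => ?_)
  · rw [heq, stepGrad]
    simpa only [π.trajRatio_self, one_smul] using h
  · rw [norm_smul, norm_smul, Real.norm_of_nonneg (π.trajRatio_pos _ _ _ _).le]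
    refine (mul_le_of_le_one_left (by have := π.trajRatio_pos θ θ' t τ; positivity)
      (M.abs_r_le i _)).trans ?_
    exact mul_le_mul (π.trajRatio_le hd hMg hg hθ' t τ) (π.norm_scoreSum_le (hg θ' hθ') t τ)
      (norm_nonneg _) (by positivity)
  · rw [hasGradientAt_iff_hasFDerivAt]
    convert! (π.hasFDerivAt_trajRatio hd θ θ' t τ).mul_const (M.r i (τ t)) using 1
    ext v
    simp

theorem summable_add_one_mul_pow (M : CMDP S A m) :
    Summable fun t : ℕ => ((t : ℝ) + 1) * M.γ ^ t := by
  have h1 := summable_pow_mul_geometric_of_norm_lt_one 1 (r := M.γ)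
    (by rw [Real.norm_of_nonneg M.γ_mem.1.le]; exact M.γ_mem.2)
  simpa [add_mul] using h1.add M.summable_pow

/-- Continuity of the values keeps the finitely many constraints strictly positive near `θ`, so a
whole ball is feasible and inherits the score bound. -/
theorem exists_ball_score_le (M : CMDP S A m) (π : PolicyFamily S A d) {Mg Mh : ℝ}
    (hB : M.BoundedScore π Mg Mh) {θ : EuclideanSpace ℝ (Fin d)}
    (hpos : ∀ i : Fin m, 0 < M.value π i.succ θ) :
    ∃ R > 0, ∀ θ' ∈ Metric.ball θ R, ∀ x, ‖π.score x θ'‖ ≤ Mg := by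
  have h : ∀ᶠ θ' in 𝓝 θ, ∀ i : Fin m, 0 < M.value π i.succ θ' :=
    eventually_all.2 fun i => ((M.continuous_value π (fun x => (hB.1 x).continuous)
      i.succ).tendsto θ).eventually_const_lt (hpos i)
  obtain ⟨R, hR, hball⟩ := Metric.eventually_nhds_iff_ball.1 h
  exact ⟨R, hR, fun θ' hθ' x => (hB.2.2 θ' (fun i => (hball θ' hθ' i).le) x).1⟩

/-- The policy gradient theorem. -/
theorem hasGradientAt_value (M : CMDP S A m) (π : PolicyFamily S A d) {Mg Mh : ℝ} (hMg : 0 ≤ Mg)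
    (hB : M.BoundedScore π Mg Mh) {θ : EuclideanSpace ℝ (Fin d)}
    (hpos : ∀ i : Fin m, 0 < M.value π i.succ θ) (i : Fin (m + 1)) :
    HasGradientAt (M.value π i) (∑' t, M.γ ^ t • M.stepGrad π i t θ) θ := by
  obtain ⟨R, hR, hg⟩ := M.exists_ball_score_le π hB hpos
  rw [M.value_eq_tsum π i]
  refine hasGradientAt_tsum_of_ball (g := fun t θ => M.γ ^ t • M.stepGrad π i t θ)
    (u := fun t => ((t : ℝ) + 1) * M.γ ^ t * Mg) hR (M.summable_add_one_mul_pow.mul_right Mg)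
    (fun t θ' hθ' => ?_) (fun t θ' hθ' => ?_) (M.hasSum_value π i θ).summable
  -- Termwise differentiation needs the derivative at every `θ'` of the ball; there the change of
  -- measure is based at `θ'`, on a smaller ball.
  · obtain ⟨R', hR', hsub⟩ := Metric.isOpen_ball.mem_nhds hθ' |> Metric.mem_nhds_iff.1
    have h := M.hasGradientAt_stepValue π hB.1 hMg hR' (fun y hy => hg y (hsub hy)) i t
    rw [hasGradientAt_iff_hasFDerivAt] at h ⊢
    convert! h.const_mul (M.γ ^ t) using 1
    simp
  · have := M.norm_stepGrad_le π (hg θ' hθ') i t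
    have hγ := pow_nonneg M.γ_mem.1.le t
    rw [norm_smul, Real.norm_of_nonneg hγ]
    calc M.γ ^ t * ‖M.stepGrad π i t θ'‖ ≤ M.γ ^ t * ((t + 1) * Mg) := by gcongr
      _ = _ := by ring

end CMDP

end PolicyGradient

/-! ### Bounds, bias and joint accuracy of the estimators. -/

section Estimators

open Filter Topology InnerProductSpace

theorem add_one_mul_pow_le {s : ℝ} (h0 : 0 ≤ s) (h1 : s < 1) (t : ℕ) :
    ((t : ℝ) + 1) * s ^ t ≤ (1 - s)⁻¹ := by
  calc ((t : ℝ) + 1) * s ^ t = ∑ _k ∈ Finset.range (t + 1), s ^ t := by simp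
    _ ≤ ∑ k ∈ Finset.range (t + 1), s ^ k := Finset.sum_le_sum fun k hk =>
        pow_le_pow_of_le_one h0 h1.le (Nat.lt_succ_iff.1 (Finset.mem_range.1 hk))
    _ ≤ ∑' k, s ^ k := (summable_geometric_of_lt_one h0 h1).sum_le_tsum _
        fun k _ => pow_nonneg h0 k
    _ = (1 - s)⁻¹ := tsum_geometric_of_lt_one h0 h1

/-- Used with `s = √γ`: one of the two factors `s ^ t` of `γ ^ t` absorbs the weight `t + 1`, the
other leaves a geometric tail. -/
theorem add_one_mul_sq_pow_le {s : ℝ} (h0 : 0 ≤ s) (h1 : s < 1) (t : ℕ) :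
    ((t : ℝ) + 1) * (s ^ 2) ^ t ≤ (1 - s)⁻¹ * s ^ t := by
  have := mul_le_mul_of_nonneg_right (add_one_mul_pow_le h0 h1 t) (pow_nonneg h0 t)
  calc ((t : ℝ) + 1) * (s ^ 2) ^ t = ((t : ℝ) + 1) * s ^ t * s ^ t := by ring
    _ ≤ _ := this

theorem hasSum_add_one_mul_pow {γ : ℝ} (h0 : 0 ≤ γ) (h1 : γ < 1) :
    HasSum (fun t : ℕ => ((t : ℝ) + 1) * γ ^ t) ((1 - γ)⁻¹ ^ 2) := by
  have hn : ‖γ‖ < 1 := by rwa [Real.norm_of_nonneg h0]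
  have h := (hasSum_coe_mul_geometric_of_norm_lt_one hn).add (hasSum_geometric_of_lt_one h0 h1)
  have h2 : (1 - γ) ≠ 0 := by linarith
  convert! h using 1
  · ext t; ring
  · field_simp; ring

/-- Truncation error of a series dominated by `C (t + 1) s ^ (2 t)`. -/
theorem norm_sum_range_sub_le_of_hasSum {E : Type*} [NormedAddCommGroup E] {f : ℕ → E} {a : E}
    {s C : ℝ} (h0 : 0 ≤ s) (h1 : s < 1) (hC : 0 ≤ C)
    (hf : ∀ t, ‖f t‖ ≤ C * (((t : ℝ) + 1) * (s ^ 2) ^ t)) (ha : HasSum f a) (H : ℕ) :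
    ‖∑ t ∈ Finset.range H, f t - a‖ ≤ C * (s ^ H / (1 - s) ^ 2) := by
  have h := norm_sub_le_of_geometric_bound_of_hasSum h1 (f := f) (C := C * (1 - s)⁻¹)
    (fun t => (hf t).trans (by
      rw [mul_assoc]
      exact mul_le_mul_of_nonneg_left (add_one_mul_sq_pow_le h0 h1 t) hC)) ha H
  refine h.trans_eq ?_
  have : 1 - s ≠ 0 := by linarith
  field_simp

variable {S A : Type*} [MeasurableSpace S] [MeasurableSpace A] {m d : ℕ}

namespace CMDP

/-- The truncated discounted return of one trajectory. -/
noncomputable def trajValue (M : CMDP S A m) (H : ℕ) (i : Fin (m + 1)) (τ : ℕ → S × A) : ℝ :=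
  ∑ t ∈ Finset.range H, M.γ ^ t * M.r i (τ t)

/-- The GPOMDP gradient estimate from one trajectory. -/
noncomputable def trajGrad (M : CMDP S A m) (π : PolicyFamily S A d)
    (θ : EuclideanSpace ℝ (Fin d)) (H : ℕ) (i : Fin (m + 1)) (τ : ℕ → S × A) :
    EuclideanSpace ℝ (Fin d) :=
  ∑ t ∈ Finset.range H, M.γ ^ t • (M.r i (τ t) • π.scoreSum θ t τ)

theorem valueEst_eq (M : CMDP S A m) (H : ℕ) {n : ℕ} (i : Fin (m + 1))
    (ω : Fin n → ℕ → S × A) :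
    M.valueEst H i ω = (n : ℝ)⁻¹ • ∑ j, M.trajValue H i (ω j) := rfl

theorem gradEst_eq (M : CMDP S A m) (π : PolicyFamily S A d) (θ : EuclideanSpace ℝ (Fin d))
    (H : ℕ) {n : ℕ} (i : Fin (m + 1)) (ω : Fin n → ℕ → S × A) :
    M.gradEst π θ H i ω = (n : ℝ)⁻¹ • ∑ j, M.trajGrad π θ H i (ω j) := by
  simp only [gradEst, trajGrad, PolicyFamily.scoreSum, smul_smul, Finset.smul_sum]

theorem measurable_trajValue (M : CMDP S A m) (H : ℕ) (i : Fin (m + 1)) :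
    Measurable (M.trajValue H i) :=
  Finset.measurable_sum _ fun t _ => (M.measurable_r_eval i t).const_mul _

theorem measurable_trajGrad (M : CMDP S A m) (π : PolicyFamily S A d)
    (hd : ∀ x, Differentiable ℝ (π.logDens x)) (θ : EuclideanSpace ℝ (Fin d)) (H : ℕ)
    (i : Fin (m + 1)) : Measurable (M.trajGrad π θ H i) :=
  Finset.measurable_sum _ fun t _ =>
    ((M.measurable_r_eval i t).smul (π.measurable_scoreSum hd θ t)).const_smul (M.γ ^ t)

theorem one_sub_γ_pos (M : CMDP S A m) : 0 < 1 - M.γ := sub_pos.2 M.γ_mem.2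

theorem abs_trajValue_le (M : CMDP S A m) (H : ℕ) (i : Fin (m + 1)) (τ : ℕ → S × A) :
    ‖M.trajValue H i τ‖ ≤ (1 - M.γ)⁻¹ := by
  calc ‖M.trajValue H i τ‖ ≤ ∑ t ∈ Finset.range H, M.γ ^ t := by
        refine norm_sum_le_of_le _ fun t _ => ?_
        have hγ := pow_nonneg M.γ_mem.1.le t
        rw [norm_mul, Real.norm_of_nonneg hγ]
        exact mul_le_of_le_one_right hγ (M.abs_r_le i _)
    _ ≤ ∑' t, M.γ ^ t := M.summable_pow.sum_le_tsum _ fun t _ => pow_nonneg M.γ_mem.1.le t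
    _ = _ := tsum_geometric_of_lt_one M.γ_mem.1.le M.γ_mem.2

theorem norm_trajGrad_le (M : CMDP S A m) (π : PolicyFamily S A d)
    {θ : EuclideanSpace ℝ (Fin d)} {Mg : ℝ} (hMg : 0 ≤ Mg) (hg : ∀ x, ‖π.score x θ‖ ≤ Mg)
    (H : ℕ) (i : Fin (m + 1)) (τ : ℕ → S × A) :
    ‖M.trajGrad π θ H i τ‖ ≤ Mg * (1 - M.γ)⁻¹ ^ 2 := by
  have hs := hasSum_add_one_mul_pow M.γ_mem.1.le M.γ_mem.2
  calc ‖M.trajGrad π θ H i τ‖ ≤ ∑ t ∈ Finset.range H, Mg * (((t : ℝ) + 1) * M.γ ^ t) := by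
        refine norm_sum_le_of_le _ fun t _ => ?_
        have hγ := pow_nonneg M.γ_mem.1.le t
        have h1 := (mul_le_of_le_one_left (norm_nonneg _) (M.abs_r_le i (τ t))).trans
          (π.norm_scoreSum_le hg t τ)
        rw [norm_smul, norm_smul, Real.norm_of_nonneg hγ]
        calc M.γ ^ t * (‖M.r i (τ t)‖ * ‖π.scoreSum θ t τ‖) ≤ M.γ ^ t * ((t + 1) * Mg) :=
              mul_le_mul_of_nonneg_left h1 hγ
          _ = _ := by ring
    _ = Mg * ∑ t ∈ Finset.range H, (((t : ℝ) + 1) * M.γ ^ t) := by rw [Finset.mul_sum]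
    _ ≤ Mg * (1 - M.γ)⁻¹ ^ 2 := by
        refine mul_le_mul_of_nonneg_left (sum_le_hasSum _ (fun t _ => ?_) hs) hMg
        exact mul_nonneg (by positivity) (pow_nonneg M.γ_mem.1.le t)

theorem integral_trajValue (M : CMDP S A m) (π : PolicyFamily S A d)
    (θ : EuclideanSpace ℝ (Fin d)) (H : ℕ) (i : Fin (m + 1)) :
    ∫ τ, M.trajValue H i τ ∂(M.trajLaw π θ) =
      ∑ t ∈ Finset.range H, M.γ ^ t * M.stepValue π i t θ := by
  unfold trajValue
  rw [integral_finsetSum _ fun t _ => (M.integrable_r_eval π i t θ).const_mul _]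
  simp only [integral_const_mul, stepValue]

theorem integral_trajGrad (M : CMDP S A m) (π : PolicyFamily S A d)
    (hd : ∀ x, Differentiable ℝ (π.logDens x)) {θ : EuclideanSpace ℝ (Fin d)} {Mg : ℝ}
    (hg : ∀ x, ‖π.score x θ‖ ≤ Mg) (H : ℕ) (i : Fin (m + 1)) :
    ∫ τ, M.trajGrad π θ H i τ ∂(M.trajLaw π θ) =
      ∑ t ∈ Finset.range H, M.γ ^ t • M.stepGrad π i t θ := by
  unfold trajGrad
  rw [integral_finsetSum _ fun t _ => (M.integrable_r_smul_scoreSum π hd hg i t).fun_smul (M.γ ^ t)]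
  simp only [integral_smul, stepGrad]

theorem norm_pow_smul_stepGrad_le (M : CMDP S A m) (π : PolicyFamily S A d)
    {θ : EuclideanSpace ℝ (Fin d)} {Mg : ℝ} (hg : ∀ x, ‖π.score x θ‖ ≤ Mg) (i : Fin (m + 1))
    (t : ℕ) : ‖M.γ ^ t • M.stepGrad π i t θ‖ ≤ Mg * (((t : ℝ) + 1) * M.γ ^ t) := by
  have hγ := pow_nonneg M.γ_mem.1.le t
  rw [norm_smul, Real.norm_of_nonneg hγ]
  calc M.γ ^ t * ‖M.stepGrad π i t θ‖ ≤ M.γ ^ t * ((t + 1) * Mg) :=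
        mul_le_mul_of_nonneg_left (M.norm_stepGrad_le π hg i t) hγ
    _ = _ := by ring

/-- The policy-gradient expression for the gradient of the value. -/
noncomputable def valueGrad (M : CMDP S A m) (π : PolicyFamily S A d)
    (i : Fin (m + 1)) (θ : EuclideanSpace ℝ (Fin d)) : EuclideanSpace ℝ (Fin d) :=
  ∑' t, M.γ ^ t • M.stepGrad π i t θ

theorem hasSum_valueGrad (M : CMDP S A m) (π : PolicyFamily S A d)
    {θ : EuclideanSpace ℝ (Fin d)} {Mg : ℝ} (hg : ∀ x, ‖π.score x θ‖ ≤ Mg) (i : Fin (m + 1)) :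
    HasSum (fun t => M.γ ^ t • M.stepGrad π i t θ) (M.valueGrad π i θ) :=
  (Summable.of_norm_bounded (M.summable_add_one_mul_pow.mul_left Mg)
    fun t => M.norm_pow_smul_stepGrad_le π hg i t).hasSum

theorem norm_valueGrad_le (M : CMDP S A m) (π : PolicyFamily S A d)
    {θ : EuclideanSpace ℝ (Fin d)} {Mg : ℝ} (hg : ∀ x, ‖π.score x θ‖ ≤ Mg) (i : Fin (m + 1)) :
    ‖M.valueGrad π i θ‖ ≤ Mg * (1 - M.γ)⁻¹ ^ 2 :=
  tsum_of_norm_bounded ((hasSum_add_one_mul_pow M.γ_mem.1.le M.γ_mem.2).mul_left Mg)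
    fun t => M.norm_pow_smul_stepGrad_le π hg i t

theorem sqrt_γ_mem (M : CMDP S A m) : 0 ≤ √M.γ ∧ √M.γ < 1 ∧ √M.γ ^ 2 = M.γ :=
  ⟨Real.sqrt_nonneg _, (Real.sqrt_lt' one_pos).2 (by simpa using M.γ_mem.2),
    Real.sq_sqrt M.γ_mem.1.le⟩

theorem abs_integral_trajValue_sub_value_le (M : CMDP S A m) (π : PolicyFamily S A d)
    (θ : EuclideanSpace ℝ (Fin d)) (H : ℕ) (i : Fin (m + 1)) :
    ‖∫ τ, M.trajValue H i τ ∂(M.trajLaw π θ) - M.value π i θ‖ ≤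
      √M.γ ^ H / (1 - √M.γ) ^ 2 := by
  obtain ⟨h0, h1, h2⟩ := M.sqrt_γ_mem
  rw [M.integral_trajValue π θ H i]
  refine (norm_sum_range_sub_le_of_hasSum h0 h1 zero_le_one (fun t => ?_)
    (M.hasSum_value π i θ) H).trans_eq (one_mul _)
  rw [h2, one_mul]
  refine (M.norm_pow_mul_stepValue_le π i t θ).trans ?_
  -- The needless weight `t + 1` gives values and gradients the same truncation factor.
  exact le_mul_of_one_le_left (pow_nonneg M.γ_mem.1.le t) 
    (by linarith [(t.cast_nonneg : (0 : ℝ) ≤ t)])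

theorem norm_integral_trajGrad_sub_valueGrad_le (M : CMDP S A m) (π : PolicyFamily S A d)
    (hd : ∀ x, Differentiable ℝ (π.logDens x)) {θ : EuclideanSpace ℝ (Fin d)} {Mg : ℝ}
    (hMg : 0 ≤ Mg) (hg : ∀ x, ‖π.score x θ‖ ≤ Mg) (H : ℕ) (i : Fin (m + 1)) :
    ‖∫ τ, M.trajGrad π θ H i τ ∂(M.trajLaw π θ) - M.valueGrad π i θ‖ ≤
      Mg * (√M.γ ^ H / (1 - √M.γ) ^ 2) := by
  obtain ⟨h0, h1, h2⟩ := M.sqrt_γ_mem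
  rw [M.integral_trajGrad π hd hg H i]
  refine norm_sum_range_sub_le_of_hasSum h0 h1 hMg (fun t => ?_) (M.hasSum_valueGrad π hg i) H
  rw [h2]
  exact M.norm_pow_smul_stepGrad_le π hg i t

theorem hasGradientAt_logBarrier (M : CMDP S A m) (π : PolicyFamily S A d) {Mg Mh : ℝ}
    (hMg : 0 ≤ Mg) (hB : M.BoundedScore π Mg Mh) {θ : EuclideanSpace ℝ (Fin d)}
    (hpos : ∀ i : Fin m, 0 < M.value π i.succ θ) (η : ℝ) :
    HasGradientAt (M.logBarrier π η) (M.valueGrad π 0 θ +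
      η • ∑ i : Fin m, (M.value π i.succ θ)⁻¹ • M.valueGrad π i.succ θ) θ := by
  have hV : ∀ i, HasFDerivAt (M.value π i) (toDual ℝ _ (M.valueGrad π i θ)) θ := fun i =>
    (M.hasGradientAt_value π hMg hB hpos i).hasFDerivAt
  rw [hasGradientAt_iff_hasFDerivAt]
  have h := (hV 0).add ((HasFDerivAt.fun_sum (u := Finset.univ) fun (i : Fin m) _ =>
    (hV i.succ).log (hpos i).ne').const_mul η)
  convert! h using 1
  simp

end CMDP

/-- Perturbation bound for the plug-in gradient of a log barrier. -/
theorem norm_barrier_sub_le {E : Type*} [NormedAddCommGroup E] [NormedSpace ℝ E] {m : ℕ}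
    {G G' : Fin (m + 1) → E} {V V' : Fin m → ℝ} {v α β L η : ℝ} (hv : 0 < v) (hη : 0 ≤ η)
    (hV : ∀ i, v ≤ V i) (hVV : ∀ i, |V' i - V i| ≤ β) (hβ : β ≤ v / 2)
    (hG : ∀ i, ‖G i‖ ≤ L) (hGG : ∀ i, ‖G' i - G i‖ ≤ α) :
    ‖(G' 0 + η • ∑ i : Fin m, (V' i)⁻¹ • G' i.succ) -
      (G 0 + η • ∑ i : Fin m, (V i)⁻¹ • G i.succ)‖ ≤
      α + η * (m * (2 * α / v + 2 * L * β / v ^ 2)) := by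
  have hterm : ∀ i : Fin m, ‖(V' i)⁻¹ • G' i.succ - (V i)⁻¹ • G i.succ‖ ≤
      2 * α / v + 2 * L * β / v ^ 2 := fun i => by
    have hVi : 0 < V i := hv.trans_le (hV i)
    -- This is where `β ≤ v / 2` enters: the estimated denominators stay away from zero.
    have hV' : v / 2 ≤ V' i := by linarith [(abs_le.1 (hVV i)).1, hV i]
    have hV'0 : 0 < V' i := by linarith
    have h1 : (V' i)⁻¹ ≤ 2 / v := by
      rw [inv_le_comm₀ hV'0 (by positivity), inv_div]; exact hV'
    have h2 : ‖(V' i)⁻¹ - (V i)⁻¹‖ ≤ 2 * β / v ^ 2 := by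
      have : (V' i)⁻¹ - (V i)⁻¹ = (V i - V' i) * ((V' i)⁻¹ * (V i)⁻¹) := by field_simp
      rw [this, norm_mul, Real.norm_eq_abs, abs_sub_comm,
        Real.norm_of_nonneg (by positivity)]
      have h3 : (V i)⁻¹ ≤ 1 / v := by rw [one_div]; exact inv_anti₀ hv (hV i)
      have hβ0 : 0 ≤ β := (abs_nonneg _).trans (hVV i)
      calc |V' i - V i| * ((V' i)⁻¹ * (V i)⁻¹) ≤ β * (2 / v * (1 / v)) := by
            gcongr; exact hVV i
        _ = _ := by field_simp
    have h4 : (V' i)⁻¹ • G' i.succ - (V i)⁻¹ • G i.succ =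
        (V' i)⁻¹ • (G' i.succ - G i.succ) + ((V' i)⁻¹ - (V i)⁻¹) • G i.succ := by
      rw [smul_sub, sub_smul]; abel
    rw [h4]
    refine (norm_add_le _ _).trans ?_
    rw [norm_smul, norm_smul, Real.norm_of_nonneg (inv_pos.2 hV'0).le]
    have hL : 0 ≤ L := (norm_nonneg _).trans (hG 0)
    calc (V' i)⁻¹ * ‖G' i.succ - G i.succ‖ + ‖(V' i)⁻¹ - (V i)⁻¹‖ * ‖G i.succ‖
        ≤ 2 / v * α + 2 * β / v ^ 2 * L :=
          add_le_add (mul_le_mul h1 (hGG _) (norm_nonneg _) (by positivity))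
            (mul_le_mul h2 (hG _) (norm_nonneg _) ((norm_nonneg _).trans h2))
      _ = _ := by ring
  have heq : (G' 0 + η • ∑ i : Fin m, (V' i)⁻¹ • G' i.succ) -
      (G 0 + η • ∑ i : Fin m, (V i)⁻¹ • G i.succ) =
      (G' 0 - G 0) + η • ∑ i : Fin m, ((V' i)⁻¹ • G' i.succ - (V i)⁻¹ • G i.succ) := by
    rw [Finset.sum_sub_distrib, smul_sub]; abel
  rw [heq]
  refine (norm_add_le _ _).trans (add_le_add (hGG 0) ?_)
  rw [norm_smul, Real.norm_of_nonneg hη]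
  refine mul_le_mul_of_nonneg_left ?_ hη
  exact (norm_sum_le _ _).trans ((Finset.sum_le_sum fun i _ => hterm i).trans_eq (by simp; ring))

namespace CMDP

/-- Simultaneous accuracy of all value and gradient estimators. -/
theorem one_sub_le_measureReal_estimators (M : CMDP S A m) (π : PolicyFamily S A d) {Mg : ℝ}
    (hMg : 0 < Mg) (hd : ∀ x, Differentiable ℝ (π.logDens x)) {θ : EuclideanSpace ℝ (Fin d)}
    (hg : ∀ x, ‖π.score x θ‖ ≤ Mg) {α β : ℝ} (hα : 0 < α) (hβ : 0 < β) {n H : ℕ} (hn : 0 < n)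
    (hHα : Mg * (√M.γ ^ H / (1 - √M.γ) ^ 2) ≤ α / 2)
    (hHβ : √M.γ ^ H / (1 - √M.γ) ^ 2 ≤ β / 2) {p : ℝ}
    (hpα : Real.exp (-(n * (α / 2) ^ 2 / (16 * (Mg * (1 - M.γ)⁻¹ ^ 2) ^ 2))) ≤ p)
    (hpβ : Real.exp (-(n * (β / 2) ^ 2 / (16 * (1 - M.γ)⁻¹ ^ 2))) ≤ p) :
    1 - 4 * (m + 1) * p ≤ (M.batchLaw π θ n).real
      {ω | ∀ i, ‖M.gradEst π θ H i ω - M.valueGrad π i θ‖ ≤ α ∧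
        |M.valueEst H i ω - M.value π i θ| ≤ β} := by
  have hγ : 0 < (1 - M.γ)⁻¹ := inv_pos.2 M.one_sub_γ_pos
  have : IsProbabilityMeasure (M.batchLaw π θ n) := by unfold batchLaw; infer_instance
  let U : Fin (m + 1) → Set (Fin n → ℕ → S × A) := fun i =>
    {ω | α / 2 < ‖(n : ℝ)⁻¹ • ∑ j, M.trajGrad π θ H i (ω j) -
      ∫ τ, M.trajGrad π θ H i τ ∂(M.trajLaw π θ)‖}
  let W : Fin (m + 1) → Set (Fin n → ℕ → S × A) := fun i =>
    {ω | β / 2 < ‖(n : ℝ)⁻¹ • ∑ j, M.trajValue H i (ω j) -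
      ∫ τ, M.trajValue H i τ ∂(M.trajLaw π θ)‖}
  have hU : ∀ i, (M.batchLaw π θ n).real (U i) ≤ 2 * p := fun i =>
    (measureReal_norm_mean_sub_integral_gt_le (M.measurable_trajGrad π hd θ H i)
      (by positivity) (M.norm_trajGrad_le π hMg.le hg H i) hn (half_pos hα)).trans (by linarith)
  have hW : ∀ i, (M.batchLaw π θ n).real (W i) ≤ 2 * p := fun i =>
    (measureReal_norm_mean_sub_integral_gt_le (M.measurable_trajValue H i)
      hγ (M.abs_trajValue_le H i) hn (half_pos hβ)).trans (by linarith)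
  set good := {ω : Fin n → ℕ → S × A | ∀ i, ‖M.gradEst π θ H i ω - M.valueGrad π i θ‖ ≤ α ∧
        |M.valueEst H i ω - M.value π i θ| ≤ β} with hgood
  -- Subadditivity on a cover of the whole space avoids complements, so the good event need not be
  -- shown measurable. Half of each accuracy goes to the deviation and half to the bias.
  have hcover : (Set.univ : Set (Fin n → ℕ → S × A)) ⊆ good ∪ ⋃ i, (U i ∪ W i) := by
    intro ω _
    by_contra hcon
    simp only [Set.mem_union, Set.mem_iUnion, not_or, not_exists] at hcon
    refine hcon.1 fun i => ?_
    have hu : ‖(n : ℝ)⁻¹ • ∑ j, M.trajGrad π θ H i (ω j) -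
      ∫ τ, M.trajGrad π θ H i τ ∂(M.trajLaw π θ)‖ ≤ α / 2 := not_lt.1 (hcon.2 i).1
    have hw : ‖(n : ℝ)⁻¹ • ∑ j, M.trajValue H i (ω j) -
      ∫ τ, M.trajValue H i τ ∂(M.trajLaw π θ)‖ ≤ β / 2 := not_lt.1 (hcon.2 i).2
    have hbu := M.norm_integral_trajGrad_sub_valueGrad_le π hd hMg.le hg H i
    have hbw := M.abs_integral_trajValue_sub_value_le π θ H i
    rw [M.gradEst_eq, M.valueEst_eq]
    constructor
    · exact (norm_sub_le_norm_sub_add_norm_sub _ _ _).trans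
        ((add_le_add hu (hbu.trans hHα)).trans_eq (add_halves α))
    · rw [← Real.norm_eq_abs]
      exact (norm_sub_le_norm_sub_add_norm_sub _ _ _).trans
        ((add_le_add hw (hbw.trans hHβ)).trans_eq (add_halves β))
  have h1 : (M.batchLaw π θ n).real (⋃ i, (U i ∪ W i)) ≤ 4 * (m + 1) * p := by
    refine (measureReal_iUnion_fintype_le _).trans ?_
    refine (Finset.sum_le_sum fun i _ => (measureReal_union_le (U i) (W i)).trans
      (add_le_add (hU i) (hW i))).trans_eq ?_
    simp; ring
  have h2 := (measureReal_mono hcover).trans (measureReal_union_le (μ := M.batchLaw π θ n) _ _)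
  rw [probReal_univ] at h2
  linarith

end CMDP

end Estimators

/-! ### Explicit thresholds and their orders. -/

section Thresholds

/-- Inverse of the accuracy that is required of the gradient estimators. -/
noncomputable def gradPrecision (m : ℕ) (η ε v : ℝ) : ℝ := 3 / ε + 6 * η * m / (ε * v)

/-- Inverse of the accuracy that is required of the value estimators. -/
noncomputable def valuePrecision (m : ℕ) (Mg γ η ε v : ℝ) : ℝ :=
  2 / v + 6 * η * m * (Mg * (1 - γ)⁻¹ ^ 2) / (ε * v ^ 2)

/-- The batch-size threshold. -/
noncomputable def batchThreshold (m : ℕ) (Mg γ η ε δ v : ℝ) : ℕ :=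
  ⌈64 * ((Mg * (1 - γ)⁻¹ ^ 2 * gradPrecision m η ε v) ^ 2 +
    ((1 - γ)⁻¹ * valuePrecision m Mg γ η ε v) ^ 2) * Real.log (4 * (m + 1) / δ)⌉₊

/-- The factor that the truncation error has to be smaller than the inverse of. -/
noncomputable def horizonFactor (m : ℕ) (Mg γ η ε v : ℝ) : ℝ :=
  2 * (Mg * gradPrecision m η ε v + valuePrecision m Mg γ η ε v) / (1 - √γ) ^ 2

/-- The horizon threshold. -/
noncomputable def horizonThreshold (m : ℕ) (Mg γ η ε v : ℝ) : ℕ :=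
  ⌈Real.log (horizonFactor m Mg γ η ε v) / Real.log (√γ)⁻¹⌉₊

theorem sqrt_lt_one {γ : ℝ} (h1 : γ < 1) : √γ < 1 :=
  (Real.sqrt_lt' one_pos).2 (by simpa using h1)

variable {m : ℕ} {Mg γ η ε δ v : ℝ}

theorem gradPrecision_pos (hη : 0 < η) (hε : 0 < ε) (hv : 0 < v) :
    0 < gradPrecision m η ε v := by
  unfold gradPrecision; positivity

theorem valuePrecision_pos (hMg : 0 < Mg) (hγ : γ < 1) (hη : 0 < η) (hε : 0 < ε) (hv : 0 < v) :
    0 < valuePrecision m Mg γ η ε v := by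
  have : 0 < (1 - γ)⁻¹ := inv_pos.2 (sub_pos.2 hγ)
  unfold valuePrecision; positivity

theorem log_div_pos (hδ : 0 < δ) (hδ1 : δ ≤ 1) : 0 < Real.log (4 * (m + 1) / δ) := by
  refine Real.log_pos ((one_lt_div hδ).2 ?_)
  have : (0 : ℝ) ≤ m := m.cast_nonneg
  linarith

/-- The factor adds up the two bias requirements, so this single inequality yields both, for values
and for gradients. -/
theorem sqrt_pow_mul_horizonFactor_le {H : ℕ} (hMg : 0 < Mg) (hγ0 : 0 < γ) (hγ : γ < 1)
    (hη : 0 < η) (hε : 0 < ε) (hv : 0 < v) (hH : horizonThreshold m Mg γ η ε v ≤ H) :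
    √γ ^ H * horizonFactor m Mg γ η ε v ≤ 1 := by
  have hs0 : 0 < √γ := Real.sqrt_pos.2 hγ0
  have hs1 : √γ < 1 := sqrt_lt_one hγ
  have ha := gradPrecision_pos (m := m) hη hε hv
  have hb := valuePrecision_pos (m := m) hMg hγ hη hε hv
  have hF : 0 < horizonFactor m Mg γ η ε v := by
    have : 0 < 1 - √γ := by linarith
    unfold horizonFactor; positivity
  have hl : 0 < Real.log (√γ)⁻¹ := Real.log_pos ((one_lt_inv₀ hs0).2 hs1)
  have h1 : Real.log (horizonFactor m Mg γ η ε v) / Real.log (√γ)⁻¹ ≤ H :=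
    (Nat.le_ceil _).trans (by exact_mod_cast hH)
  rw [div_le_iff₀ hl, ← Real.log_pow] at h1
  have h2 := (Real.log_le_log_iff hF (by positivity)).1 h1
  rw [inv_pow] at h2
  calc √γ ^ H * horizonFactor m Mg γ η ε v ≤ √γ ^ H * (√γ ^ H)⁻¹ := by gcongr
    _ = 1 := mul_inv_cancel₀ (by positivity)

theorem exp_neg_le_div_of_log_div_le {x y δ : ℝ} (hδ : 0 < δ) (hy : Real.log (y / δ) ≤ x)
    (hy0 : 0 < y) : Real.exp (-x) ≤ δ / y := by
  rw [← Real.le_log_iff_exp_le (by positivity), ← inv_div, Real.log_inv]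
  linarith

theorem batchThreshold_pos (hMg : 0 < Mg) (hγ : γ < 1) (hη : 0 < η) (hε : 0 < ε) (hδ : 0 < δ)
    (hδ1 : δ ≤ 1) (hv : 0 < v) : 0 < batchThreshold m Mg γ η ε δ v := by
  have hg : 0 < (1 - γ)⁻¹ := inv_pos.2 (sub_pos.2 hγ)
  have ha := gradPrecision_pos (m := m) hη hε hv
  have hl := log_div_pos (m := m) hδ hδ1
  unfold batchThreshold
  exact Nat.ceil_pos.2 (by positivity)

theorem log_le_mul_of_batchThreshold_le {n : ℕ} (hMg : 0 < Mg) (hγ : γ < 1) (hη : 0 < η)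
    (hε : 0 < ε) (hδ : 0 < δ) (hδ1 : δ ≤ 1) (hv : 0 < v)
    (hn : batchThreshold m Mg γ η ε δ v ≤ n) :
    Real.log (4 * (m + 1) / δ) ≤ n * ((gradPrecision m η ε v)⁻¹ / 2) ^ 2 /
        (16 * (Mg * (1 - γ)⁻¹ ^ 2) ^ 2) ∧
      Real.log (4 * (m + 1) / δ) ≤ n * ((valuePrecision m Mg γ η ε v)⁻¹ / 2) ^ 2 /
        (16 * (1 - γ)⁻¹ ^ 2) := by
  have hg : 0 < (1 - γ)⁻¹ := inv_pos.2 (sub_pos.2 hγ)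
  have ha := gradPrecision_pos (m := m) hη hε hv
  have hb := valuePrecision_pos (m := m) hMg hγ hη hε hv
  have hl := log_div_pos (m := m) hδ hδ1
  have h1 : 64 * ((Mg * (1 - γ)⁻¹ ^ 2 * gradPrecision m η ε v) ^ 2 +
      ((1 - γ)⁻¹ * valuePrecision m Mg γ η ε v) ^ 2) * Real.log (4 * (m + 1) / δ) ≤ n :=
    (Nat.le_ceil _).trans (Nat.cast_le.2 hn)
  set a := gradPrecision m η ε v
  set b := valuePrecision m Mg γ η ε v
  set l := Real.log (4 * (m + 1) / δ)
  set g := (1 - γ)⁻¹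
  have hx : 0 ≤ (Mg * g ^ 2 * a) ^ 2 * l := by positivity
  have hy : 0 ≤ (g * b) ^ 2 * l := by positivity
  constructor
  -- The 64 of the threshold is the Hoeffding constant 16 times the 4 from halving the accuracy. The
  -- threshold adds the two requirements instead of taking their maximum, so the other summand is
  -- dropped.
  · have h2 : n * (a⁻¹ / 2) ^ 2 / (16 * (Mg * g ^ 2) ^ 2) = n / (64 * (Mg * g ^ 2 * a) ^ 2) := by
      field_simp; ring
    rw [h2, le_div_iff₀ (by positivity)]
    linarith
  · have h2 : n * (b⁻¹ / 2) ^ 2 / (16 * g ^ 2) = n / (64 * (g * b) ^ 2) := by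
      field_simp; ring
    rw [h2, le_div_iff₀ (by positivity)]
    linarith

/-- With `g = 1 / (1 - γ)` and `Q = η / (ε v ^ 2)` the target is `g ^ 6 Q ^ 2 log (1 / δ)`. The
conditions on `ε` and `v` make the inverse accuracies `O(g Q)` for gradients and `O(g ^ 2 Q)` for
values; multiplied by the sizes `g ^ 2` and `g` of one sample, both become `O(g ^ 3 Q)`. As `log (1
/ δ)` is bounded below, it absorbs `log (4 (m + 1))` and the rounding. -/
theorem batchThreshold_order (hMg : 0 < Mg) (K δ₀ : ℝ) (hδ₀ : δ₀ < 1) :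
    ∃ C : ℝ, ∀ γ η ε δ v : ℝ, 0 < γ → γ < 1 → 0 < η →
      0 < ε → ε ≤ K * η → 0 < δ → δ ≤ δ₀ → 0 < v → v ≤ 1 / (1 - γ) → v ^ 2 ≤ K * η →
        (batchThreshold m Mg γ η ε δ v : ℝ) ≤
          C * (ε⁻¹ ^ 2 * (1 - γ)⁻¹ ^ 6 * v⁻¹ ^ 4 * η ^ 2 * Real.log (1 / δ)) := by
  set c := Mg ^ 2 * (3 * K + 6 * m) ^ 2 + (2 * K + 6 * m * Mg) ^ 2 with hc
  set l₀ := Real.log (1 / δ₀) with hl₀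
  -- The last summand pays for rounding up. Nonpositive `K` or `δ₀` are harmless, since then no `ε`
  -- or no `δ` is admissible.
  refine ⟨64 * c * (Real.log (4 * (m + 1)) / l₀ + 1) + K ^ 2 / l₀, ?_⟩
  intro γ η ε δ v hγ0 hγ1 hη hε hεK hδ hδδ hv hvγ hvK
  have hK : 0 < K := by
    by_contra h
    have := mul_nonpos_of_nonpos_of_nonneg (not_lt.1 h) hη.le
    linarith
  rw [one_div] at hvγ
  have hg1 : 1 ≤ (1 - γ)⁻¹ := (one_le_inv₀ (by linarith)).2 (by linarith)
  set g := (1 - γ)⁻¹ with hgdef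
  have hg : 0 < g := by linarith
  set Q := η / (ε * v ^ 2) with hQ
  have hQ0 : 0 < Q := by positivity
  have hl₀pos : 0 < l₀ := Real.log_pos ((one_lt_div (by linarith)).2 hδ₀)
  have hll : l₀ ≤ Real.log (1 / δ) :=
    Real.log_le_log (by have : 0 < δ₀ := by linarith
                        positivity) (one_div_le_one_div_of_le hδ hδδ)
  set l := Real.log (1 / δ) with hldef
  have hl : 0 < l := by linarith
  have hm0 : (0 : ℝ) ≤ m := m.cast_nonneg
  have h1ε : 1 / ε ≤ K * (g * Q) := by
    rw [hQ, div_le_iff₀ hε]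
    calc (1 : ℝ) = v ^ 2 / v ^ 2 := by field_simp
      _ ≤ K * η / v ^ 2 := by gcongr
      _ ≤ K * η / v ^ 2 * g := le_mul_of_one_le_right (by positivity) hg1
      _ = _ := by field_simp
  have hηε : η / (ε * v) ≤ g * Q := by
    calc η / (ε * v) = v * Q := by rw [hQ]; field_simp
      _ ≤ g * Q := by gcongr
  have h1v : 1 / v ≤ K * (g ^ 2 * Q) := by
    calc 1 / v = ε * v / (ε * v ^ 2) := by field_simp
      _ ≤ (K * η) * g / (ε * v ^ 2) := by gcongr
      _ = K * (g * Q) := by rw [hQ]; ring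
      _ ≤ K * (g ^ 2 * Q) := by gcongr; nlinarith
  have ha : gradPrecision m η ε v ≤ (3 * K + 6 * m) * (g * Q) := by
    calc gradPrecision m η ε v = 3 * (1 / ε) + 6 * m * (η / (ε * v)) := by
          unfold gradPrecision; ring
      _ ≤ 3 * (K * (g * Q)) + 6 * m * (g * Q) := by gcongr
      _ = _ := by ring
  have hb : valuePrecision m Mg γ η ε v ≤ (2 * K + 6 * m * Mg) * (g ^ 2 * Q) := by
    calc valuePrecision m Mg γ η ε v = 2 * (1 / v) + 6 * m * Mg * (g ^ 2 * Q) := by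
          rw [hQ]; unfold valuePrecision; ring
      _ ≤ 2 * (K * (g ^ 2 * Q)) + 6 * m * Mg * (g ^ 2 * Q) := by gcongr
      _ = _ := by ring
  have ha0 := gradPrecision_pos (m := m) hη hε hv
  have hb0 := valuePrecision_pos (m := m) hMg hγ1 hη hε hv
  have hsq : (Mg * g ^ 2 * gradPrecision m η ε v) ^ 2 + (g * valuePrecision m Mg γ η ε v) ^ 2 ≤
      c * (g ^ 6 * Q ^ 2) := by
    calc (Mg * g ^ 2 * gradPrecision m η ε v) ^ 2 + (g * valuePrecision m Mg γ η ε v) ^ 2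
        ≤ (Mg * g ^ 2 * ((3 * K + 6 * m) * (g * Q))) ^ 2 +
          (g * ((2 * K + 6 * m * Mg) * (g ^ 2 * Q))) ^ 2 := by gcongr
      _ = _ := by rw [hc]; ring
  have hlog : Real.log (4 * (m + 1) / δ) ≤ (Real.log (4 * (m + 1)) / l₀ + 1) * l := by
    have h4 : 0 ≤ Real.log (4 * ((m : ℝ) + 1)) := Real.log_nonneg (by linarith)
    have : Real.log (4 * (m + 1) / δ) = Real.log (4 * (m + 1)) + l := by
      rw [hldef, ← Real.log_mul (by positivity) (by positivity)]; congr 1; ring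
    rw [this, add_mul, one_mul]
    gcongr
    rw [div_mul_eq_mul_div, le_div_iff₀ hl₀pos]
    gcongr
  have hlog0 := log_div_pos (m := m) hδ (by linarith : δ ≤ 1)
  have hone : 1 ≤ K ^ 2 / l₀ * (g ^ 6 * Q ^ 2 * l) := by
    have h5 : 1 ≤ K * (g ^ 3 * Q) := by
      calc (1 : ℝ) ≤ g := hg1
        _ = ε * g * v ^ 2 / (ε * v ^ 2) := by field_simp
        _ ≤ (K * η) * g * g ^ 2 / (ε * v ^ 2) := by gcongr
        _ = _ := by rw [hQ]; ring
    have h6 : 1 ≤ l / l₀ := (one_le_div hl₀pos).2 hll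
    calc (1 : ℝ) ≤ (K * (g ^ 3 * Q)) ^ 2 * (l / l₀) :=
          one_le_mul_of_one_le_of_one_le (one_le_pow₀ h5) h6
      _ = _ := by ring
  have hrhs : ε⁻¹ ^ 2 * g ^ 6 * v⁻¹ ^ 4 * η ^ 2 * l = g ^ 6 * Q ^ 2 * l := by
    rw [hQ]; field_simp
  rw [hrhs]
  have hceil : (batchThreshold m Mg γ η ε δ v : ℝ) ≤
      64 * ((Mg * g ^ 2 * gradPrecision m η ε v) ^ 2 + (g * valuePrecision m Mg γ η ε v) ^ 2) *
        Real.log (4 * (m + 1) / δ) + 1 :=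
    (Nat.ceil_lt_add_one (by positivity)).le
  have hc0 : 0 ≤ c := by positivity
  calc (batchThreshold m Mg γ η ε δ v : ℝ)
      ≤ 64 * (c * (g ^ 6 * Q ^ 2)) * ((Real.log (4 * (m + 1)) / l₀ + 1) * l) +
          K ^ 2 / l₀ * (g ^ 6 * Q ^ 2 * l) := by
        refine hceil.trans (add_le_add ?_ hone)
        gcongr
    _ = _ := by ring

/-- For fixed `γ` and bounded `η`, `ε`, `v`, everything over the common denominator `(ε v) ^ 2`
bounds the horizon factor by `c / (ε v) ^ 2`, whose logarithm is `log c + 2 log (1 / (ε v))`. The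
condition `ε v ≤ q < 1` bounds the last logarithm below, which absorbs `log c` and the rounding. -/
theorem horizonThreshold_order (hMg : 0 < Mg) (γ K q : ℝ) (hγ0 : 0 < γ) (hγ1 : γ < 1)
    (hq : q < 1) :
    ∃ C : ℝ, ∀ η ε v : ℝ, 0 < η → η ≤ K → 0 < ε → ε ≤ K → 0 < v → v ≤ 1 / (1 - γ) → ε * v ≤ q →
      (horizonThreshold m Mg γ η ε v : ℝ) ≤ C * Real.log (1 / (ε * v)) := by
  have hs0 : 0 < √γ := Real.sqrt_pos.2 hγ0
  have hs1 : √γ < 1 := sqrt_lt_one hγ1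
  have hs2 : 0 < 1 - √γ := by linarith
  set L := Real.log (√γ)⁻¹ with hL
  have hL0 : 0 < L := Real.log_pos ((one_lt_inv₀ hs0).2 hs1)
  have hg : 0 < (1 - γ)⁻¹ := inv_pos.2 (sub_pos.2 hγ1)
  set g := (1 - γ)⁻¹ with hgdef
  set c := 2 * (Mg * (3 * (K * g ^ 2) + 6 * m * (K ^ 2 * g)) +
    (2 * (K ^ 2 * g) + 6 * m * (Mg * g ^ 2) * K ^ 2)) / (1 - √γ) ^ 2 with hc
  set l₀ := Real.log (1 / q) with hl₀
  refine ⟨(|Real.log c| / l₀ + 2) / L + 1 / l₀, ?_⟩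
  intro η ε v hη hηK hε hεK hv hvγ hq'
  have hK : 0 < K := by linarith
  rw [one_div, ← hgdef] at hvγ
  have hm0 : (0 : ℝ) ≤ m := m.cast_nonneg
  have hεv : 0 < ε * v := by positivity
  have hl₀pos : 0 < l₀ := Real.log_pos ((one_lt_div (by linarith)).2 hq)
  have hll : l₀ ≤ Real.log (1 / (ε * v)) :=
    Real.log_le_log (by have : 0 < q := by linarith
                        positivity) (one_div_le_one_div_of_le hεv hq')
  set l := Real.log (1 / (ε * v)) with hldef
  have hl : 0 < l := by linarith
  have ha0 := gradPrecision_pos (m := m) hη hε hv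
  have hb0 := valuePrecision_pos (m := m) hMg hγ1 hη hε hv
  have ha : gradPrecision m η ε v ≤ (3 * (K * g ^ 2) + 6 * m * (K ^ 2 * g)) / (ε * v) ^ 2 := by
    calc gradPrecision m η ε v = (3 * (ε * v ^ 2) + 6 * m * (η * ε * v)) / (ε * v) ^ 2 := by
          unfold gradPrecision; field_simp
      _ ≤ (3 * (K * g ^ 2) + 6 * m * (K * K * g)) / (ε * v) ^ 2 := by gcongr
      _ = _ := by ring
  have hb : valuePrecision m Mg γ η ε v ≤
      (2 * (K ^ 2 * g) + 6 * m * (Mg * g ^ 2) * K ^ 2) / (ε * v) ^ 2 := by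
    calc valuePrecision m Mg γ η ε v =
          (2 * (ε ^ 2 * v) + 6 * m * (Mg * g ^ 2) * (η * ε)) / (ε * v) ^ 2 := by
          unfold valuePrecision; rw [← hgdef]; field_simp
      _ ≤ (2 * (K ^ 2 * g) + 6 * m * (Mg * g ^ 2) * (K * K)) / (ε * v) ^ 2 := by gcongr
      _ = _ := by ring
  have hW0 : 0 < horizonFactor m Mg γ η ε v := by unfold horizonFactor; positivity
  have hW : horizonFactor m Mg γ η ε v ≤ c * (1 / (ε * v)) ^ 2 := by
    calc horizonFactor m Mg γ η ε v ≤
        2 * (Mg * ((3 * (K * g ^ 2) + 6 * m * (K ^ 2 * g)) / (ε * v) ^ 2) +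
          (2 * (K ^ 2 * g) + 6 * m * (Mg * g ^ 2) * K ^ 2) / (ε * v) ^ 2) / (1 - √γ) ^ 2 := by
          unfold horizonFactor; gcongr
      _ = _ := by rw [hc]; field_simp
  have hc0 : 0 < c := by positivity
  have hlogW : Real.log (horizonFactor m Mg γ η ε v) ≤ |Real.log c| + 2 * l := by
    have h1 := Real.log_le_log hW0 hW
    rw [Real.log_mul hc0.ne' (by positivity), Real.log_pow] at h1
    have h2 := le_abs_self (Real.log c)
    push_cast at h1
    linarith
  have hceil : (horizonThreshold m Mg γ η ε v : ℝ) ≤ (|Real.log c| + 2 * l) / L + 1 := by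
    have h1 : horizonThreshold m Mg γ η ε v ≤ ⌈(|Real.log c| + 2 * l) / L⌉₊ :=
      Nat.ceil_mono (by gcongr)
    have h2 : (0 : ℝ) ≤ (|Real.log c| + 2 * l) / L := by positivity
    exact le_trans (by exact_mod_cast h1) (Nat.ceil_lt_add_one h2).le
  have h6 : 1 ≤ l / l₀ := (one_le_div hl₀pos).2 hll
  calc (horizonThreshold m Mg γ η ε v : ℝ) ≤ (|Real.log c| + 2 * l) / L + 1 := hceil
    _ ≤ (|Real.log c| * (l / l₀) + 2 * l) / L + l / l₀ := by
        gcongr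
        exact le_mul_of_one_le_right (abs_nonneg _) h6
    _ = _ := by ring

end Thresholds

/-! ### Assembly. -/

theorem CMDP.minValue_le {S A : Type*} [MeasurableSpace S] [MeasurableSpace A] {m d : ℕ}
    (M : CMDP S A m) (π : PolicyFamily S A d) (θ : EuclideanSpace ℝ (Fin d)) (i : Fin m) :
    M.minValue π θ ≤ M.value π i.succ θ :=
  ciInf_le (Set.finite_range _).bddBelow i

/-- A finite infimum is attained; `1 ≤ m` matters because the real infimum over an empty index is 0.
-/
theorem CMDP.minValue_pos {S A : Type*} [MeasurableSpace S] [MeasurableSpace A] {m d : ℕ}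
    (M : CMDP S A m) (π : PolicyFamily S A d) (θ : EuclideanSpace ℝ (Fin d)) (hm : 1 ≤ m)
    (hpos : ∀ i : Fin m, 0 < M.value π i.succ θ) : 0 < M.minValue π θ := by
  have : Nonempty (Fin m) := ⟨⟨0, hm⟩⟩
  obtain ⟨i, hi⟩ := exists_eq_ciInf_of_finite (f := fun i : Fin m => M.value π i.succ θ)
  rw [CMDP.minValue, ← hi]
  exact hpos i

theorem CMDP.one_sub_le_measureReal_logBarrierGradEst {S A : Type*} [MeasurableSpace S]
    [MeasurableSpace A] {m d : ℕ} (hm : 1 ≤ m) (M : CMDP S A m) (π : PolicyFamily S A d)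
    {Mg Mh : ℝ} (hMg : 0 < Mg) (hB : M.BoundedScore π Mg Mh) {θ : EuclideanSpace ℝ (Fin d)}
    (hpos : ∀ i : Fin m, 0 < M.value π i.succ θ) {η ε δ : ℝ} (hη : 0 < η) (hε : 0 < ε)
    (hδ : 0 < δ) (hδ1 : δ ≤ 1) {n H : ℕ}
    (hn : batchThreshold m Mg M.γ η ε δ (M.minValue π θ) ≤ n)
    (hH : horizonThreshold m Mg M.γ η ε (M.minValue π θ) ≤ H) :
    1 - δ ≤ (M.batchLaw π θ n).real
      {ω | ‖M.logBarrierGradEst π η θ H ω - gradient (M.logBarrier π η) θ‖ ≤ ε} := by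
  have hv := M.minValue_pos π θ hm hpos
  have hvV := M.minValue_le π θ
  obtain ⟨hγ0, hγ1⟩ := M.γ_mem
  set v := M.minValue π θ
  have hg : ∀ x, ‖π.score x θ‖ ≤ Mg := fun x => (hB.2.2 θ (fun i => (hpos i).le) x).1
  have hg0 : 0 < (1 - M.γ)⁻¹ := inv_pos.2 M.one_sub_γ_pos
  have ha := gradPrecision_pos (m := m) hη hε hv
  have hb := valuePrecision_pos (m := m) hMg hγ1 hη hε hv
  have hm0 : (0 : ℝ) < m := by exact_mod_cast hm
  obtain ⟨hlα, hlβ⟩ := log_le_mul_of_batchThreshold_le hMg hγ1 hη hε hδ hδ1 hv hn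
  have hn0 : 0 < n := (batchThreshold_pos hMg hγ1 hη hε hδ hδ1 hv).trans_le hn
  have hs := sqrt_pow_mul_horizonFactor_le hMg hγ0 hγ1 hη hε hv hH
  set a := gradPrecision m η ε v with hadef
  set b := valuePrecision m Mg M.γ η ε v with hbdef
  set B := √M.γ ^ H / (1 - √M.γ) ^ 2 with hBdef
  have hB0 : 0 ≤ B := by positivity
  -- The accuracies are `α = a⁻¹` and `β = b⁻¹`; dropping either summand bounds one bias by half its
  -- accuracy.
  have hBs : 2 * (Mg * a + b) * B ≤ 1 := by
    refine le_trans (le_of_eq ?_) hs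
    rw [hBdef, horizonFactor]; ring
  have hHα : Mg * B ≤ a⁻¹ / 2 := by
    rw [le_div_iff₀ two_pos, ← one_div, le_div_iff₀ ha]
    nlinarith [mul_nonneg hb.le hB0]
  have hHβ : B ≤ b⁻¹ / 2 := by
    rw [le_div_iff₀ two_pos, ← one_div, le_div_iff₀ hb]
    nlinarith [mul_nonneg (mul_nonneg hMg.le ha.le) hB0]
  have key := M.one_sub_le_measureReal_estimators π hMg hB.1 hg (inv_pos.2 ha) (inv_pos.2 hb) hn0
    hHα hHβ (exp_neg_le_div_of_log_div_le hδ hlα (by positivity))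
    (exp_neg_le_div_of_log_div_le hδ hlβ (by positivity))
  -- There are `2 (m + 1)` bad events, each of probability at most `2 p`; this fixes `p = δ / (4 (m
  -- + 1))`.
  rw [show 4 * ((m : ℝ) + 1) * (δ / (4 * (m + 1))) = δ by field_simp] at key
  have : IsProbabilityMeasure (M.batchLaw π θ n) := by unfold CMDP.batchLaw; infer_instance
  refine key.trans (measureReal_mono fun ω hω => ?_)
  -- Each summand of `a` and `b` encodes one requirement of the perturbation bound: `α ≤ ε / 3`, `2
  -- η m α / v ≤ ε / 3`, `β ≤ v / 2` and `2 η m L β / v ^ 2 ≤ ε / 3` with `L = Mg / (1 - γ) ^ 2`.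
  have hax : 3 / ε ≤ a ∧ 6 * η * m / (ε * v) ≤ a := by
    rw [hadef, gradPrecision]
    exact ⟨le_add_of_nonneg_right (by positivity), le_add_of_nonneg_left (by positivity)⟩
  have hbx : 2 / v ≤ b ∧ 6 * η * m * (Mg * (1 - M.γ)⁻¹ ^ 2) / (ε * v ^ 2) ≤ b := by
    rw [hbdef, valuePrecision]
    exact ⟨le_add_of_nonneg_right (by positivity), le_add_of_nonneg_left (by positivity)⟩
  have h1 : a⁻¹ ≤ ε / 3 := by
    rw [inv_le_comm₀ ha (by positivity), inv_div]; exact hax.1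
  have h2 : a⁻¹ ≤ ε * v / (6 * η * m) := by
    rw [inv_le_comm₀ ha (by positivity), inv_div]; exact hax.2
  have h3 : b⁻¹ ≤ v / 2 := by
    rw [inv_le_comm₀ hb (by positivity), inv_div]; exact hbx.1
  have h4 : b⁻¹ ≤ ε * v ^ 2 / (6 * η * m * (Mg * (1 - M.γ)⁻¹ ^ 2)) := by
    rw [inv_le_comm₀ hb (by positivity), inv_div]; exact hbx.2
  have hfin := norm_barrier_sub_le (G := fun i => M.valueGrad π i θ)
    (G' := fun i => M.gradEst π θ H i ω) (V := fun i : Fin m => M.value π i.succ θ)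
    (V' := fun i : Fin m => M.valueEst H i.succ ω) hv hη.le hvV (fun i => (hω i.succ).2) h3
    (fun i => M.norm_valueGrad_le π hg i) (fun i => (hω i).1)
  change ‖_‖ ≤ ε
  rw [(M.hasGradientAt_logBarrier π hMg.le hB hpos η).gradient]
  refine hfin.trans ?_
  have h5 : η * (m * (2 * a⁻¹ / v)) ≤ ε / 3 := by
    calc η * (m * (2 * a⁻¹ / v)) ≤ η * (m * (2 * (ε * v / (6 * η * m)) / v)) := by gcongr
      _ = ε / 3 := by field_simp; norm_num
  have h6 : η * (m * (2 * (Mg * (1 - M.γ)⁻¹ ^ 2) * b⁻¹ / v ^ 2)) ≤ ε / 3 := by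
    calc η * (m * (2 * (Mg * (1 - M.γ)⁻¹ ^ 2) * b⁻¹ / v ^ 2))
        ≤ η * (m * (2 * (Mg * (1 - M.γ)⁻¹ ^ 2) *
            (ε * v ^ 2 / (6 * η * m * (Mg * (1 - M.γ)⁻¹ ^ 2))) / v ^ 2)) := by gcongr
      _ = ε / 3 := by
        set k := (1 - M.γ)⁻¹
        field_simp
        norm_num
  rw [mul_add, mul_add]
  linarith

theorem mainTheorem6 (m : ℕ) (hm : 1 ≤ m) (Mg : ℝ) (hMg : 0 < Mg) :
    -- batch-size threshold `n₀ γ η ε δ v` and horizon threshold `H₀ γ η ε v`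
    ∃ (n₀ : ℝ → ℝ → ℝ → ℝ → ℝ → ℕ) (H₀ : ℝ → ℝ → ℝ → ℝ → ℕ),
      -- the thresholds suffice
      (∀ (S : Type*) (A : Type*) [MeasurableSpace S] [MeasurableSpace A] (d : ℕ)
        (M : CMDP S A m) (π : PolicyFamily S A d) (Mh : ℝ), 0 < Mh → M.BoundedScore π Mg Mh →
        ∀ θ : EuclideanSpace ℝ (Fin d), (∀ i : Fin m, 0 < M.value π i.succ θ) →
        ∀ η ε δ : ℝ, 0 < η → 0 < ε → 0 < δ → δ ≤ 1 →
          DifferentiableAt ℝ (M.logBarrier π η) θ ∧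
          ∀ n H : ℕ, n₀ M.γ η ε δ (M.minValue π θ) ≤ n → H₀ M.γ η ε (M.minValue π θ) ≤ H →
            1 - δ ≤ (M.batchLaw π θ n).real
              {ω | ‖M.logBarrierGradEst π η θ H ω - gradient (M.logBarrier π η) θ‖ ≤ ε}) ∧
      -- order of the batch size
      (∀ K δ₀ : ℝ, δ₀ < 1 → ∃ C : ℝ, ∀ γ η ε δ v : ℝ, 0 < γ → γ < 1 → 0 < η →
        0 < ε → ε ≤ K * η → 0 < δ → δ ≤ δ₀ → 0 < v → v ≤ 1 / (1 - γ) → v ^ 2 ≤ K * η →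
          (n₀ γ η ε δ v : ℝ) ≤
            C * (ε⁻¹ ^ 2 * (1 - γ)⁻¹ ^ 6 * v⁻¹ ^ 4 * η ^ 2 * Real.log (1 / δ))) ∧
      -- order of the horizon
      (∀ γ K q : ℝ, 0 < γ → γ < 1 → q < 1 → ∃ C : ℝ, ∀ η ε v : ℝ, 0 < η → η ≤ K →
        0 < ε → ε ≤ K → 0 < v → v ≤ 1 / (1 - γ) → ε * v ≤ q →
          (H₀ γ η ε v : ℝ) ≤ C * Real.log (1 / (ε * v))) := by
  refine ⟨batchThreshold m Mg, horizonThreshold m Mg, ?_, batchThreshold_order hMg,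
    horizonThreshold_order hMg⟩
  intro S A _ _ d M π Mh _ hB θ hpos η ε δ hη hε hδ hδ1
  exact ⟨(M.hasGradientAt_logBarrier π hMg.le hB hpos η).differentiableAt, fun n H hn hH =>
    M.one_sub_le_measureReal_logBarrierGradEst hm π hMg hB hpos hη hε hδ hδ1 hn hH⟩
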